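/- All digraphs are finite. A tournament is a digraph without loops in which every two distinct vertices are joined by exactly one of the two possible arcs. A digraph $D=(V,E)$ is strongly connected if for all $u,v\in V$ there is a directed path from $u$ to $v$. It is strongly $k$-connected if $|V|\ge k+1$ and, for every $S\subseteq V$ with $|S|\le k-1$, the digraph $D-S$ induced on $V\setminus S$ is strongly connected. **Theorem.** For every integer $k\ge 1$ and every $n$, every strongly $k$-connected tournament $T$ on $n$ vertices has a strongly $k$-connected spanning subgraph $D$ (that is, $V(D)=V(T)$ and $E(D)\subseteq E(T)$) with at most $$kn+750\,k^2\log_2(k+1)$$ arcs. -/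

import Mathlib

namespace Digraph

/-- A tournament: no loops, and between two distinct vertices exactly one of the two possible
arcs is present. -/
structure IsTournament {V : Type*} (T : Digraph V) : Prop where
  irrefl : ∀ v, ¬ T.Adj v v
  adj_iff_not_adj : ∀ u v, u ≠ v → (T.Adj u v ↔ ¬ T.Adj v u)

/-- The set of arcs of a digraph, as ordered pairs of vertices. -/
def arcSet {V : Type*} (D : Digraph V) : Set (V × V) := {p | D.Adj p.1 p.2}

/-- `D - S`: the digraph induced by `D` on the complement of the vertex set `S`. -/
def deleteVerts {V : Type*} (D : Digraph V) (S : Finset V) : Digraph {v : V // v ∉ S} where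
  Adj u v := D.Adj u.1 v.1

/-- Every vertex can be reached from every vertex along arcs (a directed walk between two vertices
can be shortened to a directed path; the trivial path goes from a vertex to itself). -/
def StronglyConnected {V : Type*} (D : Digraph V) : Prop :=
  ∀ u v : V, Relation.ReflTransGen D.Adj u v

/-- Strong `k`-connectedness: there are at least `k + 1` vertices, and deleting any set of at most
`k - 1` vertices leaves a strongly connected digraph. -/
def StronglyKConnected {V : Type*} [Fintype V] (k : ℕ) (D : Digraph V) : Prop :=
  k + 1 ≤ Fintype.card V ∧ ∀ S : Finset V, S.card < k → (D.deleteVerts S).StronglyConnected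

end Digraph

/-!
The subgraph has about `k` arcs at each vertex, which lead forward along an order of the vertices or
along disjoint paths backward, and `O(k² log k)` further arcs around a small set `W` of vertices.

Forward arcs. In a median order of a tournament each vertex dominates at least half of every segment
that follows it, and is dominated by at least half of every segment that precedes it
(`TournamentRel.exists_median_order`). By Hall's theorem (`SemiDense.exists_matching`) this gives,
even after the removal of a bounded number of arcs at each vertex, an acyclic digraph with at most `q`
arcs per vertex in which all vertices but `O(q)` at either end have out-degree and in-degree at
least `q` (`TournamentRel.exists_acyclic_regular`). With `q = k`, after the deletion of a set `S` of
fewer than `k` vertices one can move on from every vertex but the last few.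

Terminal part. In a tournament there are `3 * k` disjoint sets of `O(log k)` vertices, each with a
sink, such that almost every vertex has an out-neighbour in every set; `k` of the sinks, forming a
set `X`, are dominated by at least `k` other sinks each (`TournamentRel.exists_dominating_family`,
`TournamentRel.exists_terminal`). The vertices at the end of the order get an arc to each of the sets.
As `S` misses at least one of any `k` disjoint sets, they still reach every remaining vertex of `X`.
The exceptional vertices that have no out-neighbour in some set are so few, in comparison with their
out-degrees, that each of them has `k` out-neighbours which are not exceptional. In the same way all
vertices are reached from a set `Y` of sources. The union of all these sets, with one more vertex
`ys`, is `W`. The vertices of `W` are led out of it by peeling off vertices of large degree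
(`TournamentRel.exists_peeling`) and by fans from the at most `2 * k` vertices left, which exist by
Menger's theorem (`RobustlyConnected.exists_fan`, `TournamentRel.exists_outward_arcs`).

Backward paths. To return from `X` to `Y`, `k` disjoint paths are needed, one of which avoids `S`
(`exists_linkage`). They could be long, and in order not to pay for their arcs, the vertices on the
paths get only `k - 1` forward arcs instead of `k`. Then a vertex `v` on a path is stuck only if `S`
consists of exactly the heads of its forward arcs. In this case one follows the path of `v` to its
end: if it met `S` on the way, there would be a forward arc from `v` to a later vertex of the path,
which is excluded since the forward arcs are chosen off the paths and the paths have no chords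
(`exists_chordless_linkage`). As `S` then avoids `ys`, one can go on from the end of the path in `Y`
to `ys`, which has an in-neighbour in each of the sets around `Y` and an out-neighbour in each of those
around `X`, and from there to `X`. The forward digraphs are chosen separately on the blocks of a
partition of the complement of `W`, so that vertices on the paths, exceptional vertices and the others
are kept apart (`TournamentRel.exists_sparse_of_large`).

All of this requires that the number of vertices is larger than a multiple of `k * log k`. If it is
smaller, peeling and fans suffice: they lead all vertices to `k` vertices of large out-degree, which
reach `k` vertices of large in-degree whatever is deleted (`TournamentRel.exists_robust_sets`,
`TournamentRel.exists_sparse_of_small`).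
-/

open scoped Classical

/-! ### Walks avoiding a vertex set, and degrees in tournaments -/

/-- `Reach r S u v`: there is a walk from `u` to `v` along `r`, every step of which has both ends
outside `S`. The trivial walk is allowed even when `u = v` lies in `S`. -/
def Reach {V : Type*} (r : V → V → Prop) (S : Finset V) : V → V → Prop :=
  Relation.ReflTransGen fun a b => r a b ∧ a ∉ S ∧ b ∉ S

/-- A relation is a tournament if it is irreflexive and relates every two distinct points in exactly
one direction. -/
structure TournamentRel {V : Type*} (r : V → V → Prop) : Prop where
  irrefl : ∀ v, ¬ r v v
  iff_not : ∀ u v, u ≠ v → (r u v ↔ ¬ r v u)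

/-- Deleting fewer than `k` vertices leaves every remaining vertex reachable from every other. This
is strong `k`-connectedness without the condition on the number of vertices. -/
def RobustlyConnected {V : Type*} (k : ℕ) (r : V → V → Prop) : Prop :=
  ∀ S : Finset V, S.card < k → ∀ u v, u ∉ S → v ∉ S → Reach r S u v

/-- The relation given by a finite set of arcs. -/
def ArcRel {V : Type*} (E : Finset (V × V)) : V → V → Prop := fun u v => (u, v) ∈ E

section Basics

variable {V : Type*} {r r' : V → V → Prop} {S : Finset V} {u v w : V}

theorem Reach.mono (h : ∀ a b, r a b → r' a b) (H : Reach r S u v) : Reach r' S u v :=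
  Relation.ReflTransGen.mono (fun _ _ hab => ⟨h _ _ hab.1, hab.2⟩) _ _ H

theorem Reach.refl : Reach r S u u := Relation.ReflTransGen.refl

theorem Reach.trans (h₁ : Reach r S u v) (h₂ : Reach r S v w) : Reach r S u w :=
  Relation.ReflTransGen.trans h₁ h₂

theorem Reach.single (h : r u v) (hu : u ∉ S) (hv : v ∉ S) : Reach r S u v :=
  Relation.ReflTransGen.single ⟨h, hu, hv⟩

theorem Reach.flip (H : Reach r S u v) : Reach (flip r) S v u := by
  induction H with
  | refl => exact Reach.refl
  | tail _ h ih => exact (Reach.single (r := _root_.flip r) h.1 h.2.2 h.2.1).trans ih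

theorem Reach.unflip (H : Reach (_root_.flip r) S u v) : Reach r S v u := Reach.flip H

theorem TournamentRel.flip (h : TournamentRel r) : TournamentRel (flip r) :=
  ⟨h.irrefl, fun u v huv => h.iff_not v u huv.symm⟩

theorem RobustlyConnected.flip {k : ℕ} (h : RobustlyConnected k r) :
    RobustlyConnected k (flip r) :=
  fun S hS u v hu hv => (h S hS v u hv hu).flip

theorem TournamentRel.or (h : TournamentRel r) (huv : u ≠ v) : r u v ∨ r v u := by
  have := h.iff_not u v huv
  tauto

theorem TournamentRel.asymm (h : TournamentRel r) (huv : r u v) : ¬ r v u := by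
  have hne : u ≠ v := fun e => h.irrefl v (e ▸ huv)
  exact (h.iff_not u v hne).1 huv

theorem TournamentRel.ne (h : TournamentRel r) (huv : r u v) : u ≠ v :=
  fun e => h.irrefl v (e ▸ huv)

/-- In a tournament the out- and in-neighbours of a vertex of `U` make up the rest of `U`. -/
theorem TournamentRel.card_out_add_card_in (h : TournamentRel r) (U : Finset V) (hu : u ∈ U) :
    (U.filter (r u)).card + (U.filter fun z => r z u).card + 1 = U.card := by
  have h1 : U.filter (fun z => r z u) = (U.erase u).filter (fun z => ¬ r u z) := by
    ext z
    simp only [Finset.mem_filter, Finset.mem_erase]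
    constructor
    · rintro ⟨hz, hr⟩
      exact ⟨⟨h.ne hr, hz⟩, h.asymm hr⟩
    · rintro ⟨⟨hne, hz⟩, hr⟩
      exact ⟨hz, (h.or hne).resolve_right hr⟩
  have h2 : U.filter (r u) = (U.erase u).filter (r u) := by
    ext z
    simp only [Finset.mem_filter, Finset.mem_erase]
    exact ⟨fun ⟨hz, hr⟩ => ⟨⟨(h.ne hr).symm, hz⟩, hr⟩, fun ⟨⟨_, hz⟩, hr⟩ => ⟨hz, hr⟩⟩
  rw [h1, h2, Finset.card_filter_add_card_filter_not]
  exact Finset.card_erase_add_one hu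

theorem TournamentRel.exists_out_ge (h : TournamentRel r) {U : Finset V} (hU : U.Nonempty) :
    ∃ u ∈ U, U.card ≤ 2 * (U.filter (r u)).card + 1 := by
  by_contra! hcon
  have hsum : ∑ u ∈ U, (U.filter (r u)).card = ∑ u ∈ U, (U.filter fun z => r z u).card := by
    simp only [Finset.card_filter]
    exact Finset.sum_comm
  have h1 : ∑ u ∈ U, ((U.filter (r u)).card + (U.filter fun z => r z u).card + 1)
      = ∑ _u ∈ U, U.card := Finset.sum_congr rfl fun u hu => h.card_out_add_card_in U hu
  have h2 : ∑ u ∈ U, (2 * (U.filter (r u)).card + 1) < ∑ _u ∈ U, U.card :=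
    Finset.sum_lt_sum_of_nonempty hU hcon
  rw [Finset.sum_add_distrib, Finset.sum_add_distrib, ← hsum] at h1
  rw [Finset.sum_add_distrib, ← Finset.mul_sum] at h2
  omega

theorem TournamentRel.exists_in_ge (h : TournamentRel r) {U : Finset V} (hU : U.Nonempty) :
    ∃ u ∈ U, U.card ≤ 2 * (U.filter fun z => r z u).card + 1 :=
  h.flip.exists_out_ge hU

/-- Vertices of out-degree at least `k` can be peeled off a tournament one after another until at
most `2 * k` vertices are left. Keeping `k` arcs at each peeled vertex gives a sparse set of arcs
along which every vertex outside the remainder `F` has `k` later out-neighbours. -/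
theorem TournamentRel.exists_peeling (h : TournamentRel r) (k : ℕ) (W : Finset V) :
    ∃ (E : Finset (V × V)) (F : Finset V) (τ : V → ℕ), F ⊆ W ∧ F.card ≤ 2 * k ∧
      E.card ≤ k * W.card ∧ (∀ e ∈ E, r e.1 e.2) ∧
      ∀ w ∈ W, w ∉ F → ∃ K : Finset V, K.card = k ∧ ∀ z ∈ K, z ∈ W ∧ (w, z) ∈ E ∧ τ z < τ w := by
  induction hn : W.card generalizing W with
  | zero =>
    rw [Finset.card_eq_zero] at hn
    subst hn
    exact ⟨∅, ∅, fun _ => 0, by simp, by simp, by simp, by simp, by simp⟩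
  | succ n ih =>
    by_cases hk : W.card ≤ 2 * k
    · exact ⟨∅, W, fun _ => 0, subset_rfl, hk, by simp, by simp, fun w hw hw' => absurd hw hw'⟩
    obtain ⟨u, hu, hdeg⟩ := h.exists_out_ge (Finset.card_pos.1 (by omega) : W.Nonempty)
    obtain ⟨K, hKsub, hKcard⟩ := Finset.exists_subset_card_eq (show k ≤ (W.filter (r u)).card by omega)
    obtain ⟨E, F, τ, hF, hFc, hE, hEr, hrank⟩ := ih (W.erase u) (by
      rw [Finset.card_erase_of_mem hu]; omega)
    have hKW : ∀ z ∈ K, z ∈ W ∧ r u z := fun z hz => Finset.mem_filter.1 (hKsub hz)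
    have hKu : ∀ z ∈ K, z ≠ u := fun z hz => (h.ne (hKW z hz).2).symm
    refine ⟨E ∪ K.image (fun z => (u, z)), F, fun z => if z = u then W.sup τ + 1 else τ z,
      hF.trans (Finset.erase_subset _ _), hFc, ?_, ?_, ?_⟩
    · refine (Finset.card_union_le _ _).trans ?_
      have := Finset.card_image_le (s := K) (f := fun z => (u, z))
      have : k * (n + 1) = k * n + k := by ring
      omega
    · intro e he
      rcases Finset.mem_union.1 he with he | he
      · exact hEr e he
      · obtain ⟨z, hz, rfl⟩ := Finset.mem_image.1 he
        exact (hKW z hz).2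
    · intro w hw hwF
      by_cases hwu : w = u
      · subst hwu
        refine ⟨K, hKcard, fun z hz => ⟨(hKW z hz).1, ?_, ?_⟩⟩
        · exact Finset.mem_union_right _ (Finset.mem_image_of_mem _ hz)
        · simp only [hKu z hz, if_false, if_true]
          exact Nat.lt_succ_of_le (Finset.le_sup (hKW z hz).1)
      · obtain ⟨K', hK', hprop⟩ := hrank w (Finset.mem_erase.2 ⟨hwu, hw⟩) hwF
        refine ⟨K', hK', fun z hz => ?_⟩
        obtain ⟨h1, h2, h3⟩ := hprop z hz
        refine ⟨(Finset.mem_erase.1 h1).2, Finset.mem_union_left _ h2, ?_⟩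
        simp only [(Finset.mem_erase.1 h1).1, hwu, if_false]
        exact h3

theorem Finset.exists_subset_card_minimizing (U : Finset V) (f : V → ℕ) {k : ℕ} (hk : k ≤ U.card) :
    ∃ L ⊆ U, L.card = k ∧ ∀ a ∈ L, ∀ b ∈ U, b ∉ L → f a ≤ f b := by
  induction k with
  | zero => exact ⟨∅, by simp, by simp, by simp⟩
  | succ k ih =>
    obtain ⟨L, hL, hc, hmin⟩ := ih (by omega)
    have hne : (U \ L).Nonempty := by
      rw [← Finset.card_pos, Finset.card_sdiff_of_subset hL]; omega
    obtain ⟨x, hx, hxmin⟩ := Finset.exists_min_image (U \ L) f hne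
    rw [Finset.mem_sdiff] at hx
    refine ⟨insert x L, Finset.insert_subset hx.1 hL, ?_, ?_⟩
    · rw [Finset.card_insert_of_notMem hx.2, hc]
    · intro a ha b hb hbL
      rw [Finset.mem_insert, not_or] at hbL
      rcases Finset.mem_insert.1 ha with rfl | ha
      · exact hxmin b (Finset.mem_sdiff.2 ⟨hb, hbL.2⟩)
      · exact hmin a ha b hb hbL.2

/-- The vertices with fewer than `k` in-neighbours induce a tournament whose in-degrees are all below
`k`, so there are at most `2 * k` of them. -/
theorem TournamentRel.exists_large_inDegree (hr : TournamentRel r) {k : ℕ} {U : Finset V}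
    (hU : 3 * k ≤ U.card) :
    ∃ X ⊆ U, X.card = k ∧ ∀ x ∈ X, k ≤ (U.filter fun z => r z x).card := by
  have hbad : (U.filter fun x => ¬ k ≤ (U.filter fun z => r z x).card).card ≤ 2 * k := by
    refine not_lt.1 fun hlt => ?_
    set Bad := U.filter fun x => ¬ k ≤ (U.filter fun z => r z x).card with hBad
    obtain ⟨u, hu, hdeg⟩ := hr.exists_in_ge (Finset.card_pos.1 (by omega) : Bad.Nonempty)
    have h1 := (Finset.mem_filter.1 hu).2
    have h2 : (Bad.filter fun z => r z u).card ≤ (U.filter fun z => r z u).card :=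
      Finset.card_le_card (Finset.filter_subset_filter _ (Finset.filter_subset _ _))
    omega
  have hsum := Finset.card_filter_add_card_filter_not (s := U)
    (fun x => k ≤ (U.filter fun z => r z x).card)
  obtain ⟨X, hX, hXc⟩ := Finset.exists_subset_card_eq
    (show k ≤ (U.filter fun x => k ≤ (U.filter fun z => r z x).card).card by omega)
  exact ⟨X, hX.trans (Finset.filter_subset _ _), hXc, fun x hx => (Finset.mem_filter.1 (hX hx)).2⟩

/-- In a tournament with at least `7 * k` vertices there are sets `L` and `X` of `k` vertices such
that, whenever fewer than `k` vertices are deleted, each remaining vertex of `L` reaches each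
remaining vertex of `X`. The vertices of largest out-degree serve as `L`, those of largest in-degree
as `X`. -/
theorem TournamentRel.exists_robust_sets (h : TournamentRel r) {k : ℕ} {J : Finset V}
    (hJ : 7 * k ≤ J.card) :
    ∃ L ⊆ J, ∃ X ⊆ J, L.card = k ∧ X.card = k ∧ ∀ S : Finset V, S.card < k →
      ∀ a ∈ L, ∀ x ∈ X, a ∉ S → x ∉ S → Reach (fun u v => r u v ∧ u ∈ J ∧ v ∈ J) S a x := by
  obtain ⟨L, hLJ, hLc, hL⟩ := J.exists_subset_card_minimizing
    (fun v => (J.filter fun z => r z v).card) (k := k) (by omega)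
  obtain ⟨X, hXJ, hXc, hX⟩ := J.exists_subset_card_minimizing
    (fun v => (J.filter (r v)).card) (k := k) (by omega)
  refine ⟨L, hLJ, X, hXJ, hLc, hXc, fun S hS a ha x hx haS hxS => ?_⟩
  by_contra hcon
  -- `R` is the part reachable from `a`; all arcs between `R` and the rest `Q` point into `R`.
  set R := J.filter fun z => z ∉ S ∧ Reach (fun u v => r u v ∧ u ∈ J ∧ v ∈ J) S a z with hR
  set Q := J.filter fun z => z ∉ S ∧ ¬ Reach (fun u v => r u v ∧ u ∈ J ∧ v ∈ J) S a z with hQ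
  have haR : a ∈ R := by simp [hR, hLJ ha, haS, Reach.refl]
  have hxQ : x ∈ Q := by simp [hQ, hXJ hx, hxS, hcon]
  have hRQ : ∀ q ∈ Q, ∀ z ∈ R, r q z := by
    intro q hq z hz
    simp only [hQ, hR, Finset.mem_filter] at hq hz
    have hne : q ≠ z := fun e => hq.2.2 (e ▸ hz.2.2)
    refine (h.or hne).resolve_right fun hzq => hq.2.2 ?_
    exact hz.2.2.trans (Reach.single ⟨hzq, hz.1, hq.1⟩ hz.2.1 hq.2.1)
  have hcover : J.card ≤ R.card + Q.card + S.card := by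
    have : J ⊆ R ∪ Q ∪ S := by
      intro z hz
      simp only [Finset.mem_union, hR, hQ, Finset.mem_filter]
      tauto
    exact (Finset.card_le_card this).trans ((Finset.card_union_le _ _).trans
      (Nat.add_le_add_right (Finset.card_union_le _ _) _))
  have hRJ : R ⊆ J := Finset.filter_subset _ _
  have hQJ : Q ⊆ J := Finset.filter_subset _ _
  have hRQd : Disjoint R Q := by
    rw [Finset.disjoint_left]
    intro z hz hz'
    simp only [hQ, hR, Finset.mem_filter] at hz hz'
    exact hz'.2.2 hz.2.2
  -- A vertex of `Q` of large out-degree within `Q` dominates all of `R` as well, so it would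
  -- beat `a`.
  have hQbound : Q.card ≤ 3 * k := by
    by_contra! hbig
    have hne : (Q \ L).Nonempty := by
      rw [← Finset.card_pos]
      have := Finset.le_card_sdiff L Q
      omega
    obtain ⟨q, hq, hdeg⟩ := h.exists_out_ge hne
    rw [Finset.mem_sdiff] at hq
    have h1 := hL a ha q (hQJ hq.1) hq.2
    have e1 := h.card_out_add_card_in J (hLJ ha)
    have e2 := h.card_out_add_card_in J (hQJ hq.1)
    have h2 : R.card + ((Q \ L).filter (r q)).card ≤ (J.filter (r q)).card := by
      rw [← Finset.card_union_of_disjoint]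
      · refine Finset.card_le_card (Finset.union_subset (fun z hz => ?_) (fun z hz => ?_))
        · exact Finset.mem_filter.2 ⟨hRJ hz, hRQ q hq.1 z hz⟩
        · rw [Finset.mem_filter, Finset.mem_sdiff] at hz
          exact Finset.mem_filter.2 ⟨hQJ hz.1.1, hz.2⟩
      · exact hRQd.mono_right ((Finset.filter_subset _ _).trans Finset.sdiff_subset)
    have h3 : (J.filter (r a)).card ≤ R.card + S.card := by
      refine (Finset.card_le_card ?_).trans (Finset.card_union_le _ _)
      intro z hz
      rw [Finset.mem_filter] at hz
      by_cases hzS : z ∈ S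
      · exact Finset.mem_union_right _ hzS
      · exact Finset.mem_union_left _ (Finset.mem_filter.2 ⟨hz.1, hzS,
          Reach.single ⟨hz.2, hLJ ha, hz.1⟩ haS hzS⟩)
    have := Finset.le_card_sdiff L Q
    omega
  have hRbound : R.card ≤ 3 * k := by
    by_contra! hbig
    have hne : (R \ X).Nonempty := by
      rw [← Finset.card_pos]
      have := Finset.le_card_sdiff X R
      omega
    obtain ⟨q, hq, hdeg⟩ := h.exists_in_ge hne
    rw [Finset.mem_sdiff] at hq
    have h1 := hX x hx q (hRJ hq.1) hq.2
    have e1 := h.card_out_add_card_in J (hXJ hx)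
    have e2 := h.card_out_add_card_in J (hRJ hq.1)
    have h2 : Q.card + ((R \ X).filter fun z => r z q).card ≤ (J.filter fun z => r z q).card := by
      rw [← Finset.card_union_of_disjoint]
      · refine Finset.card_le_card (Finset.union_subset (fun z hz => ?_) (fun z hz => ?_))
        · exact Finset.mem_filter.2 ⟨hQJ hz, hRQ z hz q hq.1⟩
        · rw [Finset.mem_filter, Finset.mem_sdiff] at hz
          exact Finset.mem_filter.2 ⟨hRJ hz.1.1, hz.2⟩
      · exact hRQd.symm.mono_right ((Finset.filter_subset _ _).trans Finset.sdiff_subset)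
    have h3 : (J.filter fun z => r z x).card ≤ Q.card + S.card := by
      refine (Finset.card_le_card ?_).trans (Finset.card_union_le _ _)
      intro z hz
      rw [Finset.mem_filter] at hz
      by_cases hzS : z ∈ S
      · exact Finset.mem_union_right _ hzS
      · refine Finset.mem_union_left _ (Finset.mem_filter.2 ⟨hz.1, hzS, fun hreach => hcon ?_⟩)
        exact hreach.trans (Reach.single ⟨hz.2, hz.1, hXJ hx⟩ hzS hxS)
    have := Finset.le_card_sdiff X R
    omega
  omega

/-- Along ranks that strictly decrease, a property passes to every vertex with a successor for which
the property is assumed. -/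
theorem reach_of_rank {S : Finset V} {target : V} (ρ : V → ℕ) (P : V → Prop)
    (step : ∀ v, v ∉ S → P v → Reach r S v target ∨ ∃ z, z ∉ S ∧ P z ∧ ρ z < ρ v ∧ r v z) :
    ∀ v, v ∉ S → P v → Reach r S v target := by
  intro v
  induction hn : ρ v using Nat.strong_induction_on generalizing v with
  | _ n ih =>
    intro hv hP
    rcases step v hv hP with h | ⟨z, hz, hPz, hlt, hvz⟩
    · exact h
    · exact (Reach.single hvz hv hz).trans (ih (ρ z) (hn ▸ hlt) z rfl hz hPz)

end Basics

/-! ### Disjoint paths: Menger's theorem and fans -/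

/-- `k` pairwise disjoint paths from `A` to `B`: the `i`-th path visits `p i 0, …, p i (L i)`. The
values of `p i` beyond `L i` are irrelevant. -/
structure Linkage {V : Type*} (r : V → V → Prop) (A B : Finset V) {k : ℕ} (p : Fin k → ℕ → V)
    (L : Fin k → ℕ) : Prop where
  start : ∀ i, p i 0 ∈ A
  finish : ∀ i, p i (L i) ∈ B
  step : ∀ i t, t < L i → r (p i t) (p i (t + 1))
  inj : ∀ i j s t, s ≤ L i → t ≤ L j → p i s = p j t → i = j ∧ s = t

/-- The arcs of a system of paths. -/
noncomputable def pathArcs {V : Type*} {k : ℕ} (p : Fin k → ℕ → V) (L : Fin k → ℕ) :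
    Finset (V × V) :=
  Finset.univ.biUnion fun i => (Finset.range (L i)).image fun t => (p i t, p i (t + 1))

section Paths

variable {V : Type*} {r : V → V → Prop} {A B : Finset V} {k : ℕ} {p : Fin k → ℕ → V}
  {L : Fin k → ℕ}

theorem mem_pathArcs {e : V × V} :
    e ∈ pathArcs p L ↔ ∃ i, ∃ t < L i, e = (p i t, p i (t + 1)) := by
  simp only [pathArcs, Finset.mem_biUnion, Finset.mem_univ, true_and, Finset.mem_image,
    Finset.mem_range, eq_comm]

theorem card_pathArcs_le : (pathArcs p L).card ≤ ∑ i, L i := by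
  refine Finset.card_biUnion_le.trans (Finset.sum_le_sum fun i _ => ?_)
  exact Finset.card_image_le.trans (Finset.card_range _).le

theorem Linkage.sum_le_card (h : Linkage r A B p L) {U : Finset V}
    (hU : ∀ i, ∀ t < L i, p i t ∈ U) : ∑ i, L i ≤ U.card := by
  have : ∑ i, L i = (Finset.univ.sigma fun i => Finset.range (L i)).card := by
    simp [Finset.card_sigma]
  rw [this]
  refine Finset.card_le_card_of_injOn (fun x => p x.1 x.2) ?_ ?_
  · rintro ⟨i, t⟩ hx
    simp only [Finset.coe_sigma, Set.mem_sigma_iff, Finset.coe_range, Set.mem_Iio] at hx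
    exact hU i t hx.2
  · rintro ⟨i, s⟩ hx ⟨j, t⟩ hy hxy
    simp only [Finset.coe_sigma, Set.mem_sigma_iff, Finset.coe_range, Set.mem_Iio] at hx hy
    obtain ⟨rfl, rfl⟩ := h.inj i j s t hx.2.le hy.2.le hxy
    rfl

theorem Linkage.exists_clean (h : Linkage r A B p L) {S : Finset V} (hS : S.card < k) :
    ∃ i, ∀ t ≤ L i, p i t ∉ S := by
  by_contra! hcon
  choose t ht hmem using hcon
  have := Finset.card_le_card_of_injOn (s := Finset.univ) (t := S) (fun i => p i (t i))
    (fun i _ => hmem i) (fun i _ j _ hij => (h.inj i j _ _ (ht i) (ht j) hij).1)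
  simp at this
  omega

theorem Linkage.reach {S : Finset V} {i : Fin k} {s t : ℕ} (hst : s ≤ t)
    (ht : t ≤ L i) (hS : ∀ u, s ≤ u → u ≤ t → p i u ∉ S) :
    Reach (ArcRel (pathArcs p L)) S (p i s) (p i t) := by
  induction t, hst using Nat.le_induction with
  | base => exact Reach.refl
  | succ t hst ih =>
    refine (ih (by omega) fun u h1 h2 => hS u h1 (by omega)).trans (Reach.single ?_ ?_ ?_)
    · exact mem_pathArcs.2 ⟨i, t, by omega, rfl⟩
    · exact hS t hst (by omega)
    · exact hS (t + 1) (by omega) le_rfl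

/-- Menger's theorem. It is the case of Hall's marriage theorem in which each vertex has to be sent
to itself or to an out-neighbour, except that `k` vertices of `B` are sent to dummies and `k` dummies
are sent to vertices of `A`: the orbits of the dummies are the paths, and a violation of Hall's
condition is a separating set. -/
theorem exists_linkage [Fintype V]
    (hsep : ∀ S : Finset V, S.card < k → ∃ a ∈ A, ∃ b ∈ B, a ∉ S ∧ b ∉ S ∧ Reach r S a b) :
    ∃ (p : Fin k → ℕ → V) (L : Fin k → ℕ), Linkage r A B p L := by
  rcases Nat.eq_zero_or_pos k with rfl | hk
  · exact ⟨fun i => i.elim0, fun i => i.elim0, ⟨fun i => i.elim0, fun i => i.elim0,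
      fun i => i.elim0, fun i => i.elim0⟩⟩
  obtain ⟨a₀, ha₀, -⟩ := hsep ∅ (by simpa using hk)
  let R : V ⊕ Fin k → V ⊕ Fin k → Prop := fun x y =>
    Sum.elim (fun v => Sum.elim (fun u => v = u ∨ r v u) (fun _ => v ∈ B) y)
      (fun _ => Sum.elim (fun a => a ∈ A) (fun _ => False) y) x
  have hall : ∀ 𝒜 : Finset (V ⊕ Fin k),
      𝒜.card ≤ (Finset.univ.filter fun y => ∃ x ∈ 𝒜, R x y).card := by
    intro 𝒜
    set I := Finset.univ.filter fun y => ∃ x ∈ 𝒜, R x y with hI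
    rw [← Finset.card_toLeft_add_card_toRight (u := 𝒜),
      ← Finset.card_toLeft_add_card_toRight (u := I)]
    have hDk : 𝒜.toRight.card ≤ k := by simpa using Finset.card_le_univ 𝒜.toRight
    have hsub : 𝒜.toLeft ⊆ I.toLeft := fun v hv => by
      simp only [Finset.mem_toLeft, hI, Finset.mem_filter, Finset.mem_univ, true_and] at hv ⊢
      exact ⟨Sum.inl v, hv, Or.inl rfl⟩
    have hle := Finset.card_le_card hsub
    by_cases hB : ∃ v ∈ 𝒜.toLeft, v ∈ B
    · obtain ⟨v, hv, hvB⟩ := hB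
      have : I.toRight = Finset.univ := by
        ext e
        simp only [Finset.mem_toRight, hI, Finset.mem_filter, Finset.mem_univ, true_and, iff_true]
        exact ⟨Sum.inl v, by simpa using hv, hvB⟩
      rw [this, Finset.card_univ, Fintype.card_fin]
      omega
    rcases 𝒜.toRight.eq_empty_or_nonempty with hD | ⟨d, hd⟩
    · rw [hD, Finset.card_empty]; omega
    by_contra! hlt
    obtain ⟨a, ha, b, hb, haS, hbS, hreach⟩ := hsep (I.toLeft \ 𝒜.toLeft) (by
      rw [Finset.card_sdiff_of_subset hsub]; omega)
    have key : ∀ z, Reach r (I.toLeft \ 𝒜.toLeft) a z → z ∈ 𝒜.toLeft := by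
      intro z hz
      have hstay : ∀ z, z ∈ I.toLeft → z ∉ I.toLeft \ 𝒜.toLeft → z ∈ 𝒜.toLeft := by
        intro z hz hz'
        rw [Finset.mem_sdiff] at hz'
        tauto
      induction hz with
      | refl =>
        refine hstay a ?_ haS
        simp only [Finset.mem_toLeft, hI, Finset.mem_filter, Finset.mem_univ, true_and]
        exact ⟨Sum.inr d, by simpa using hd, ha⟩
      | @tail y z _ hyz ih =>
        refine hstay z ?_ hyz.2.2
        simp only [Finset.mem_toLeft, hI, Finset.mem_filter, Finset.mem_univ, true_and]
        exact ⟨Sum.inl y, by simpa using ih, Or.inr hyz.1⟩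
    exact hB ⟨b, key b hreach, hb⟩
  obtain ⟨f, hf, hfR⟩ := (Fintype.all_card_le_filter_rel_iff_exists_injective R).1 hall
  have hret : ∀ i : Fin k, ∃ m, (f^[m + 1] (Sum.inr i)).isRight := by
    intro i
    obtain ⟨n, hn, hper⟩ := hf.mem_periodicPts (Sum.inr i)
    obtain ⟨m, rfl⟩ : ∃ m, n = m + 1 := ⟨n - 1, by omega⟩
    exact ⟨m, by rw [hper.eq]; rfl⟩
  have hfirst : ∀ i : Fin k, ∃ a ∈ A, f (Sum.inr i) = Sum.inl a := by
    intro i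
    have := hfR (Sum.inr i)
    rcases h : f (Sum.inr i) with a | e
    · exact ⟨a, by simpa [R, h] using this, rfl⟩
    · simp [R, h] at this
  let m : Fin k → ℕ := fun i => Nat.find (hret i)
  have hm : ∀ i, (f^[m i + 1] (Sum.inr i)).isRight := fun i => Nat.find_spec (hret i)
  have hmin : ∀ i t, t < m i → ∃ v, f^[t + 1] (Sum.inr i) = Sum.inl v := by
    intro i t ht
    have := Nat.find_min (hret i) ht
    rcases h : f^[t + 1] (Sum.inr i) with v | e
    · exact ⟨v, rfl⟩
    · simp [h] at this
  have hmpos : ∀ i, 0 < m i := by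
    intro i
    rw [Nat.pos_iff_ne_zero]
    intro h0
    obtain ⟨a, -, ha⟩ := hfirst i
    have := hm i
    rw [h0] at this
    simp [ha] at this
  let p : Fin k → ℕ → V := fun i t => Sum.elim id (fun _ => a₀) (f^[t + 1] (Sum.inr i))
  have hp : ∀ i t, t ≤ m i - 1 → f^[t + 1] (Sum.inr i) = Sum.inl (p i t) := by
    intro i t ht
    obtain ⟨v, hv⟩ := hmin i t (by have := hmpos i; omega)
    simp only [p]
    rw [hv]
    rfl
  have hcancel : ∀ i j s t, s ≤ t → t ≤ m j - 1 →
      f^[s + 1] (Sum.inr i) = f^[t + 1] (Sum.inr j) → i = j ∧ s = t := by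
    intro i j s t hst ht h
    obtain ⟨d, rfl⟩ := Nat.exists_eq_add_of_le hst
    rw [show s + d + 1 = (s + 1) + d by ring, Function.iterate_add_apply f (s + 1) d] at h
    have h' := hf.iterate (s + 1) h
    rcases d with _ | d
    · simpa using h'
    · obtain ⟨v, hv⟩ := hmin j d (by omega)
      rw [hv] at h'
      simp at h'
  refine ⟨p, fun i => m i - 1, ⟨fun i => ?_, fun i => ?_, fun i t ht => ?_, ?_⟩⟩
  · obtain ⟨a, ha, hfa⟩ := hfirst i
    have h0 := hp i 0 (Nat.zero_le _)
    simp only [zero_add, Function.iterate_one] at h0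
    rw [h0] at hfa
    rw [Sum.inl.inj hfa]
    exact ha
  · have h1 := hp i (m i - 1) le_rfl
    have h2 := hm i
    have h3 := hfR (Sum.inl (p i (m i - 1)))
    rw [Function.iterate_succ_apply', show m i = m i - 1 + 1 by have := hmpos i; omega, h1] at h2
    rcases h : f (Sum.inl (p i (m i - 1))) with v | e
    · rw [h] at h2; simp at h2
    · simpa [R, h] using h3
  · have h1 := hp i t (by omega)
    have h2 := hp i (t + 1) (by omega)
    have h3 := hfR (Sum.inl (p i t))
    have h4 : f (Sum.inl (p i t)) = Sum.inl (p i (t + 1)) := by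
      rw [← h2, Function.iterate_succ_apply', h1]
    rw [h4] at h3
    rcases (show p i t = p i (t + 1) ∨ r (p i t) (p i (t + 1)) by simpa [R] using h3) with h | h
    · exfalso
      have := (hcancel i i t (t + 1) (by omega) (by omega) (by rw [h1, h2, h])).2
      omega
    · exact h
  · intro i j s t hs ht hst
    have h : f^[s + 1] (Sum.inr i) = f^[t + 1] (Sum.inr j) := by
      rw [hp i s hs, hp j t ht, hst]
    rcases le_total s t with hle | hle
    · exact hcancel i j s t hle ht h
    · obtain ⟨h1, h2⟩ := hcancel j i t s hle hs h.symm
      exact ⟨h1.symm, h2.symm⟩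

/-- Replacing one path of a system by a path along some of its own vertices. -/
theorem Linkage.update (h : Linkage r A B p L) (i : Fin k) (φ : ℕ → ℕ) (hφ : StrictMono φ) (M : ℕ)
    (hM : φ M ≤ L i) (h0 : p i (φ 0) ∈ A) (h1 : p i (φ M) ∈ B)
    (hstep : ∀ t < M, r (p i (φ t)) (p i (φ (t + 1)))) :
    Linkage r A B (Function.update p i fun t => p i (φ t)) (Function.update L i M) := by
  have hbound : ∀ t ≤ M, φ t ≤ L i := fun t ht => (hφ.monotone ht).trans hM
  refine ⟨fun j => ?_, fun j => ?_, fun j t ht => ?_, fun j l s t hs ht hst => ?_⟩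
  · by_cases hj : j = i
    · subst hj; simpa using h0
    · simpa [hj] using h.start j
  · by_cases hj : j = i
    · subst hj; simpa using h1
    · simpa [hj] using h.finish j
  · by_cases hj : j = i
    · subst hj
      simp only [Function.update_self] at ht ⊢
      exact hstep t ht
    · simp only [Function.update_of_ne hj] at ht ⊢
      exact h.step j t ht
  · by_cases hj : j = i <;> by_cases hl : l = i
    · subst hj; subst hl
      simp only [Function.update_self] at hs ht hst
      exact ⟨rfl, hφ.injective (h.inj _ _ _ _ (hbound s hs) (hbound t ht) hst).2⟩
    · subst hj
      simp only [Function.update_self, Function.update_of_ne hl] at hs ht hst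
      exact absurd (h.inj _ _ _ _ (hbound s hs) ht hst).1.symm hl
    · subst hl
      simp only [Function.update_self, Function.update_of_ne hj] at hs ht hst
      exact absurd (h.inj _ _ _ _ hs (hbound t ht) hst).1 hj
    · simp only [Function.update_of_ne hj, Function.update_of_ne hl] at hs ht hst
      exact h.inj _ _ _ _ hs ht hst

/-- Among all systems of `k` disjoint paths one of minimum total length has no forward chords, and
each of its paths meets `B` only in its last vertex. -/
theorem exists_chordless_linkage [Fintype V]
    (hsep : ∀ S : Finset V, S.card < k → ∃ a ∈ A, ∃ b ∈ B, a ∉ S ∧ b ∉ S ∧ Reach r S a b) :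
    ∃ (p : Fin k → ℕ → V) (L : Fin k → ℕ), Linkage r A B p L ∧
      (∀ i s t, s < t → t ≤ L i → r (p i s) (p i t) → t = s + 1) ∧
      ∀ i, ∀ s < L i, p i s ∉ B := by
  obtain ⟨p₀, L₀, h₀⟩ := exists_linkage hsep
  have hex : ∃ n, ∃ (p : Fin k → ℕ → V) (L : Fin k → ℕ), Linkage r A B p L ∧ ∑ i, L i = n :=
    ⟨_, p₀, L₀, h₀, rfl⟩
  obtain ⟨p, L, h, hsum⟩ := Nat.find_spec hex
  have hmin : ∀ (i : Fin k) (φ : ℕ → ℕ) (M : ℕ), StrictMono φ → φ M ≤ L i → p i (φ 0) ∈ A →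
      p i (φ M) ∈ B → (∀ t < M, r (p i (φ t)) (p i (φ (t + 1)))) → L i ≤ M := by
    intro i φ M hφ hM h0 h1 hstep
    by_contra! hlt
    refine Nat.find_min hex ?_ ⟨_, _, h.update i φ hφ M hM h0 h1 hstep, rfl⟩
    rw [← hsum]
    refine Finset.sum_lt_sum (fun j _ => ?_) ⟨i, Finset.mem_univ i, ?_⟩
    · by_cases hj : j = i
      · subst hj; simpa using hlt.le
      · simp [hj]
    · simpa using hlt
  refine ⟨p, L, h, fun i s t hst ht hr => ?_, fun i s hs hB => ?_⟩
  · have := hmin i (fun u => if u ≤ s then u else u + (t - s - 1)) (L i - (t - s - 1)) ?_ ?_ ?_ ?_ ?_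
    · omega
    · intro a b hab
      change (if a ≤ s then a else _) < (if b ≤ s then b else _)
      split_ifs <;> omega
    · split_ifs <;> omega
    · simpa using h.start i
    · rw [if_neg (by omega), show L i - (t - s - 1) + (t - s - 1) = L i by omega]
      exact h.finish i
    · intro u hu
      rcases lt_trichotomy u s with hus | rfl | hus
      · rw [if_pos hus.le, if_pos (by omega)]
        exact h.step i u (by omega)
      · rw [if_pos le_rfl, if_neg (by omega), show u + 1 + (t - u - 1) = t by omega]
        exact hr
      · rw [if_neg (by omega), if_neg (by omega),
          show u + 1 + (t - s - 1) = u + (t - s - 1) + 1 by omega]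
        exact h.step i _ (by omega)
  · have := hmin i id s strictMono_id hs.le (h.start i) hB
      fun t ht => h.step i t (by omega)
    omega

/-- A fan: `k` paths from `f` to `Z` that are disjoint except in `f` survive the deletion of fewer
than `k` vertices, and have at most one arc for each vertex outside `Z` and `k` further ones. -/
theorem RobustlyConnected.exists_fan [Fintype V] (hr : RobustlyConnected k r) (f : V)
    {Z : Finset V} (hZ : k ≤ Z.card) :
    ∃ Φ : Finset (V × V), Φ.card ≤ Zᶜ.card + k ∧ (∀ e ∈ Φ, r e.1 e.2) ∧
      ∀ S : Finset V, S.card < k → f ∉ S → ∃ z ∈ Z, z ∉ S ∧ Reach (ArcRel Φ) S f z := by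
  by_cases hfZ : f ∈ Z
  · exact ⟨∅, by simp, by simp, fun S _ hf => ⟨f, hfZ, hf, Reach.refl⟩⟩
  let r' : V → V → Prop := fun u v => r u v ∧ u ≠ f ∧ v ≠ f
  have hsep : ∀ S : Finset V, S.card < k → ∃ a ∈ Finset.univ.filter (r f), ∃ b ∈ Z,
      a ∉ S ∧ b ∉ S ∧ Reach r' S a b := by
    intro S hS
    obtain ⟨z, hz, hzS⟩ : ∃ z ∈ Z, z ∉ S := by
      by_contra! hcon
      have := Finset.card_le_card (show Z ⊆ S from hcon)
      omega
    have hzf : z ≠ f := fun e => hfZ (e ▸ hz)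
    have hreach := hr (S.erase f) ((Finset.card_erase_le).trans_lt hS) f z (by simp)
      (fun h => hzS (Finset.mem_erase.1 h).2)
    have key : ∀ z, Reach r (S.erase f) f z → z = f ∨ ∃ a, r f a ∧ a ∉ S ∧ Reach r' S a z := by
      intro z hz
      induction hz with
      | refl => exact Or.inl rfl
      | @tail y z _ hyz ih =>
        by_cases hzf : z = f
        · exact Or.inl hzf
        have hzS : z ∉ S := fun h => hyz.2.2 (Finset.mem_erase.2 ⟨hzf, h⟩)
        right
        by_cases hyf : y = f
        · exact ⟨z, hyf ▸ hyz.1, hzS, Reach.refl⟩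
        have hyS : y ∉ S := fun h => hyz.2.1 (Finset.mem_erase.2 ⟨hyf, h⟩)
        obtain ⟨a, ha, haS, hay⟩ := ih.resolve_left hyf
        exact ⟨a, ha, haS, hay.trans (Reach.single ⟨hyz.1, hyf, hzf⟩ hyS hzS)⟩
    obtain ⟨a, ha, haS, haz⟩ := (key z hreach).resolve_left hzf
    exact ⟨a, by simpa using ha, z, hz, haS, hzS, haz⟩
  obtain ⟨p, L, h, -, hend⟩ := exists_chordless_linkage hsep
  have hfirst : ∀ i, r f (p i 0) := fun i => (Finset.mem_filter.1 (h.start i)).2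
  refine ⟨(Finset.univ.image fun i => (f, p i 0)) ∪ pathArcs p L, ?_, ?_, ?_⟩
  · have h1 : (Finset.univ.image fun i => (f, p i 0)).card ≤ k := by
      simpa using Finset.card_image_le (s := (Finset.univ : Finset (Fin k)))
        (f := fun i => (f, p i 0))
    have h2 := h.sum_le_card (U := Zᶜ) fun i t ht => Finset.mem_compl.2 (hend i t ht)
    have h3 := card_pathArcs_le (p := p) (L := L)
    have h4 := Finset.card_union_le (Finset.univ.image fun i => (f, p i 0)) (pathArcs p L)
    omega
  · intro e he
    rcases Finset.mem_union.1 he with he | he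
    · obtain ⟨i, -, rfl⟩ := Finset.mem_image.1 he
      exact hfirst i
    · obtain ⟨i, t, ht, rfl⟩ := mem_pathArcs.1 he
      exact (h.step i t ht).1
  · intro S hS hf
    obtain ⟨i, hi⟩ := h.exists_clean hS
    refine ⟨p i (L i), h.finish i, hi _ le_rfl, ?_⟩
    refine (Reach.single (v := p i 0) ?_ hf (hi 0 (Nat.zero_le _))).trans
      ((Linkage.reach (Nat.zero_le _) le_rfl fun u _ hu => hi u hu).mono fun a b hab => ?_)
    · exact Finset.mem_union_left _ (Finset.mem_image_of_mem _ (Finset.mem_univ i))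
    · exact Finset.mem_union_right _ hab

end Paths

/-! ### Median orders -/

/-- The number of pairs of entries of a list that are related in the order of the list. -/
noncomputable def forwardCount {V : Type*} (r : V → V → Prop) : List V → ℕ
  | [] => 0
  | a :: l => l.countP (fun z => r a z) + forwardCount r l

section Median

variable {V : Type*} {r : V → V → Prop}

theorem forwardCount_append (x y : List V) : forwardCount r (x ++ y) =
    forwardCount r x + forwardCount r y + (x.map fun a => y.countP fun z => r a z).sum := by
  induction x with
  | nil => simp [forwardCount]
  | cons a x ih =>
    simp only [List.cons_append, forwardCount, List.countP_append, ih, List.map_cons, List.sum_cons]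
    omega

/-- Rearranging a segment of a list changes the number of forward pairs by the change within the
segment. -/
theorem forwardCount_segment {x y : List V} (h : x.Perm y) (p s : List V)
    (hle : forwardCount r (p ++ x ++ s) ≤ forwardCount r (p ++ y ++ s)) :
    forwardCount r x ≤ forwardCount r y := by
  have h1 : (x.map fun a => s.countP fun z => r a z).sum =
      (y.map fun a => s.countP fun z => r a z).sum := (h.map _).sum_eq
  have h2 : (p.map fun a => x.countP fun z => r a z) = p.map fun a => y.countP fun z => r a z :=
    List.map_congr_left fun a _ => h.countP_eq _
  simp only [forwardCount_append, List.map_append, List.sum_append, h1, h2] at hle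
  omega

theorem TournamentRel.countP_add_countP (hr : TournamentRel r) {a : V} {q : List V} (ha : a ∉ q) :
    (q.countP fun z => r a z) + (q.countP fun z => r z a) = q.length := by
  induction q with
  | nil => simp
  | cons b q ih =>
    rw [List.mem_cons, not_or] at ha
    have := ih ha.2
    have h3 := hr.iff_not a b ha.1
    simp only [List.countP_cons, List.length_cons]
    by_cases hab : r a b
    · have hba := h3.1 hab
      simp only [hab, hba, decide_true, decide_false, if_true, Bool.false_eq_true, if_false]
      omega
    · have hba : r b a := by tauto
      simp only [hab, hba, decide_true, decide_false, if_true, Bool.false_eq_true, if_false]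
      omega

theorem card_filter_Ico_eq_countP (P : V → Prop) (v : ℕ → V) (a m : ℕ) :
    ((Finset.Ico a (a + m)).filter fun t => P (v t)).card =
      ((List.range' a m).map v).countP fun z => P z := by
  induction m with
  | zero => simp
  | succ m ih =>
    rw [← add_assoc, ← Finset.insert_Ico_right_eq_Ico_add_one (Nat.le_add_right a m),
      Finset.filter_insert, List.range'_concat, List.map_append, List.countP_append]
    split_ifs with h
    · rw [Finset.card_insert_of_notMem (by simp), ih]
      simp [h]
    · rw [ih]
      simp [h]

/-- Every finite set of vertices of a tournament has a median order: every vertex dominates at least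
half of each segment that follows it, and is dominated by at least half of each segment that
precedes it. An order with the maximum number of forward arcs has this property. -/
theorem TournamentRel.exists_median_order [Inhabited V] (hr : TournamentRel r) (C : Finset V) :
    ∃ v : ℕ → V, (∀ i < C.card, v i ∈ C) ∧ (∀ i < C.card, ∀ j < C.card, v i = v j → i = j) ∧
      (∀ u ∈ C, ∃ i < C.card, v i = u) ∧ ∀ i j, i < j → j < C.card →
        j - i ≤ 2 * ((Finset.Ioc i j).filter fun t => r (v i) (v t)).card ∧
        j - i ≤ 2 * ((Finset.Ico i j).filter fun t => r (v t) (v j)).card := by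
  obtain ⟨l, hl, hmax⟩ := Finset.exists_max_image C.toList.permutations.toFinset (forwardCount r)
    ⟨C.toList, by simp⟩
  simp only [List.mem_toFinset, List.mem_permutations] at hl hmax
  have hlen : l.length = C.card := by rw [hl.length_eq, Finset.length_toList]
  have hnd : l.Nodup := hl.nodup_iff.2 C.nodup_toList
  have hmem : ∀ u, u ∈ l ↔ u ∈ C := fun u => by rw [hl.mem_iff, Finset.mem_toList]
  have hseg : ∀ p x y s, l = p ++ x ++ s → y.Perm x → forwardCount r y ≤ forwardCount r x := by
    intro p x y s hlx hyx
    refine forwardCount_segment hyx p s ?_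
    rw [← hlx]
    refine hmax _ (List.Perm.trans ?_ hl)
    rw [hlx]
    exact (List.Perm.append_left p hyx).append_right s
  let v : ℕ → V := fun t => l.getD t default
  have hv : ∀ t (h : t < l.length), v t = l[t] := fun t h => by simp [v, h]
  have hslice : ∀ a m, a + m ≤ l.length → (l.drop a).take m = (List.range' a m).map v := by
    intro a m ham
    apply List.ext_getElem
    · simp; omega
    · intro i h1 h2
      simp only [List.length_map, List.length_range'] at h2
      simp only [List.getElem_take, List.getElem_drop, List.getElem_map, List.getElem_range', one_mul]
      rw [hv _ (by omega)]
  have hsplit : ∀ a m, a + m ≤ l.length →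
      l = l.take a ++ (List.range' a m).map v ++ l.drop (a + m) := by
    intro a m ham
    rw [← hslice a m ham, List.append_assoc, ← List.drop_drop, List.take_append_drop,
      List.take_append_drop]
  have hnotin : ∀ i a m, i < l.length → a + m ≤ l.length → (i < a ∨ a + m ≤ i) →
      v i ∉ (List.range' a m).map v := by
    intro i a m hi ham hia hmemi
    rw [List.mem_map] at hmemi
    obtain ⟨t, ht, hti⟩ := hmemi
    rw [List.mem_range'_1] at ht
    rw [hv i hi, hv t (by omega)] at hti
    have := (hnd.getElem_inj_iff).1 hti
    omega
  refine ⟨v, fun i hi => ?_, fun i hi j hj hij => ?_, fun u hu => ?_, fun i j hij hj => ⟨?_, ?_⟩⟩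
  · rw [← hmem, hv i (by omega)]
    exact List.getElem_mem _
  · rw [hv i (by omega), hv j (by omega)] at hij
    exact (hnd.getElem_inj_iff).1 hij
  · obtain ⟨i, hi, rfl⟩ := List.getElem_of_mem ((hmem u).2 hu)
    exact ⟨i, by omega, hv i hi⟩
  · obtain ⟨m, rfl⟩ := Nat.exists_eq_add_of_lt hij
    have hI : Finset.Ioc i (i + m + 1) = Finset.Ico (i + 1) (i + 1 + (m + 1)) := by
      ext t; simp only [Finset.mem_Ioc, Finset.mem_Ico]; omega
    rw [hI, card_filter_Ico_eq_countP (fun z => r (v i) z)]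
    have h1 := hsplit i (m + 2) (by omega)
    rw [List.range'_succ, List.map_cons] at h1
    have h2 := hseg _ _ ((List.range' (i + 1) (m + 1)).map v ++ [v i]) _ h1
      (List.perm_append_singleton _ _)
    rw [forwardCount_append] at h2
    have h3 := hr.countP_add_countP (hnotin i (i + 1) (m + 1) (by omega) (by omega) (by omega))
    simp only [forwardCount, List.countP_nil, List.countP_singleton, List.length_map,
      List.length_range'] at h2 h3
    have h4 : ∀ q : List V, (q.map fun a => if decide (r a (v i)) = true then 1 else 0).sum
        = q.countP fun z => r z (v i) := by
      intro q
      induction q with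
      | nil => rfl
      | cons b q ih => simp only [List.map_cons, List.sum_cons, List.countP_cons, ih]; omega
    rw [h4] at h2
    omega
  · obtain ⟨m, rfl⟩ := Nat.exists_eq_add_of_lt hij
    rw [add_assoc, card_filter_Ico_eq_countP (fun z => r z (v (i + (m + 1))))]
    have h1 := hsplit i (m + 2) (by omega)
    rw [List.range'_concat, List.map_append] at h1
    simp only [one_mul, List.map_cons, List.map_nil] at h1
    have h2 := hseg _ _ (v (i + (m + 1)) :: (List.range' i (m + 1)).map v) _ h1
      (List.perm_append_singleton _ _).symm
    rw [forwardCount_append] at h2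
    have h3 := hr.countP_add_countP
      (hnotin (i + (m + 1)) i (m + 1) (by omega) (by omega) (by omega))
    simp only [forwardCount, List.countP_nil, List.countP_singleton, List.length_map,
      List.length_range'] at h2 h3
    have h4 : ∀ (w : V) (q : List V), (q.map fun a => if decide (r a w) = true then 1 else 0).sum
        = q.countP fun z => r z w := by
      intro w q
      induction q with
      | nil => rfl
      | cons b q ih => simp only [List.map_cons, List.sum_cons, List.countP_cons, ih]; omega
    rw [h4] at h2
    omega

end Median

/-! ### Sparse forward digraphs with large degrees -/

/-- On `{0, …, N - 1}`, the relation `G` relates each point to at least half of each segment that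
follows it, up to a loss of `s`, and likewise for the segments that precede it. -/
def SemiDense (G : ℕ → ℕ → Prop) (N s : ℕ) : Prop :=
  ∀ i j, i < j → j < N → j - i ≤ 2 * ((Finset.Ioc i j).filter (G i)).card + 2 * s ∧
    j - i ≤ 2 * ((Finset.Ico i j).filter fun t => G t j).card + 2 * s

section Matching

variable {G : ℕ → ℕ → Prop} {N s : ℕ}

theorem SemiDense.card_right (h : SemiDense G N s) {X Y : Finset ℕ}
    (hXY : ∀ x ∈ X, ∀ y ∈ Y, ¬ G x y) {i j : ℕ} (hi : i ∈ X) (hij : i ≤ j) (hj : j < N) :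
    2 * (Y.filter fun t => i < t ∧ t ≤ j).card ≤ (j - i) + 2 * s := by
  rcases hij.eq_or_lt with rfl | hij
  · rw [Finset.filter_eq_empty_iff.2 fun t _ => by omega]; simp
  have h1 := (h i j hij hj).1
  have h2 : (Y.filter fun t => i < t ∧ t ≤ j).card + ((Finset.Ioc i j).filter (G i)).card ≤
      (Finset.Ioc i j).card := by
    rw [← Finset.card_union_of_disjoint]
    · refine Finset.card_le_card (Finset.union_subset (fun t ht => ?_) (Finset.filter_subset _ _))
      exact Finset.mem_Ioc.2 (Finset.mem_filter.1 ht).2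
    · rw [Finset.disjoint_left]
      intro t ht ht'
      exact hXY i hi t (Finset.mem_filter.1 ht).1 (Finset.mem_filter.1 ht').2
  rw [Nat.card_Ioc] at h2
  omega

theorem SemiDense.card_left (h : SemiDense G N s) {X Y : Finset ℕ}
    (hXY : ∀ x ∈ X, ∀ y ∈ Y, ¬ G x y) {i j : ℕ} (hj : j ∈ Y) (hij : i ≤ j) (hjN : j < N) :
    2 * (X.filter fun t => i ≤ t ∧ t < j).card ≤ (j - i) + 2 * s := by
  rcases hij.eq_or_lt with rfl | hij
  · rw [Finset.filter_eq_empty_iff.2 fun t _ => by omega]; simp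
  have h1 := (h i j hij hjN).2
  have h2 : (X.filter fun t => i ≤ t ∧ t < j).card + ((Finset.Ico i j).filter fun t => G t j).card ≤
      (Finset.Ico i j).card := by
    rw [← Finset.card_union_of_disjoint]
    · refine Finset.card_le_card (Finset.union_subset (fun t ht => ?_) (Finset.filter_subset _ _))
      exact Finset.mem_Ico.2 (Finset.mem_filter.1 ht).2
    · rw [Finset.disjoint_left]
      intro t ht ht'
      exact hXY t (Finset.mem_filter.1 ht).1 j hj (Finset.mem_filter.1 ht').2
  rw [Nat.card_Ico] at h2
  omega

/-- Two sets with no arc from the first to the second overlap little: between the first and the last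
common point, the out-neighbours of the former avoid `Y` and the in-neighbours of the latter
avoid `X`. -/
theorem SemiDense.card_add_card_le (h : SemiDense G N s) {X Y : Finset ℕ}
    (hXY : ∀ x ∈ X, ∀ y ∈ Y, ¬ G x y) {a b : ℕ} (hb : b ≤ N) (hX : X ⊆ Finset.Ico a b)
    (hY : Y ⊆ Finset.Ico a b) : X.card + Y.card ≤ (b - a) + 2 * s + 1 := by
  rcases (X ∩ Y).eq_empty_or_nonempty with hZ | hZ
  · have h1 : X.card + Y.card = (X ∪ Y).card :=
      (Finset.card_union_of_disjoint (Finset.disjoint_iff_inter_eq_empty.2 hZ)).symm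
    have h2 := Finset.card_le_card (Finset.union_subset hX hY)
    rw [Nat.card_Ico] at h2
    omega
  set i := (X ∩ Y).min' hZ with hi
  set j := (X ∩ Y).max' hZ with hj
  have hiZ := Finset.mem_inter.1 ((X ∩ Y).min'_mem hZ)
  have hjZ := Finset.mem_inter.1 ((X ∩ Y).max'_mem hZ)
  have hij : i ≤ j := Finset.min'_le_max' _ hZ
  have hjb := Finset.mem_Ico.1 (hX hjZ.1)
  have hia := Finset.mem_Ico.1 (hX hiZ.1)
  rw [← hj] at hjZ hjb
  rw [← hi] at hiZ hia
  have h1 := h.card_right hXY hiZ.1 hij (by omega)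
  have h2 := h.card_left hXY hjZ.2 hij (by omega)
  have h3 : X.card ≤ (X.filter fun t => i ≤ t ∧ t < j).card + 1 +
      (X.filter fun t => t < i ∨ j < t).card := by
    have : X ⊆ (X.filter fun t => i ≤ t ∧ t < j) ∪ {j} ∪ X.filter fun t => t < i ∨ j < t := by
      intro t ht
      simp only [Finset.mem_union, Finset.mem_filter, Finset.mem_singleton]
      simp only [ht, true_and]
      omega
    refine (Finset.card_le_card this).trans ((Finset.card_union_le _ _).trans ?_)
    exact Nat.add_le_add_right ((Finset.card_union_le _ _).trans (by simp)) _
  have h4 : Y.card ≤ (Y.filter fun t => i < t ∧ t ≤ j).card + 1 +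
      (Y.filter fun t => t < i ∨ j < t).card := by
    have : Y ⊆ (Y.filter fun t => i < t ∧ t ≤ j) ∪ {i} ∪ Y.filter fun t => t < i ∨ j < t := by
      intro t ht
      simp only [Finset.mem_union, Finset.mem_filter, Finset.mem_singleton]
      simp only [ht, true_and]
      omega
    refine (Finset.card_le_card this).trans ((Finset.card_union_le _ _).trans ?_)
    exact Nat.add_le_add_right ((Finset.card_union_le _ _).trans (by simp)) _
  have h5 : (X.filter fun t => t < i ∨ j < t).card + (Y.filter fun t => t < i ∨ j < t).card +
      (Finset.Icc i j).card ≤ (Finset.Ico a b).card := by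
    rw [← Finset.card_union_of_disjoint, ← Finset.card_union_of_disjoint]
    · refine Finset.card_le_card (Finset.union_subset (Finset.union_subset
        ((Finset.filter_subset _ _).trans hX) ((Finset.filter_subset _ _).trans hY)) fun t ht => ?_)
      rw [Finset.mem_Icc] at ht
      rw [Finset.mem_Ico]
      omega
    · rw [Finset.disjoint_left]
      intro t ht ht'
      rw [Finset.mem_Icc] at ht'
      simp only [Finset.mem_union, Finset.mem_filter] at ht
      omega
    · rw [Finset.disjoint_left]
      intro t ht ht'
      rw [Finset.mem_filter] at ht ht'
      have htZ : t ∈ X ∩ Y := Finset.mem_inter.2 ⟨ht.1, ht'.1⟩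
      have := (X ∩ Y).min'_le t htZ
      have := (X ∩ Y).le_max' t htZ
      omega
  rw [Nat.card_Icc, Nat.card_Ico] at h5
  omega

/-- If `X` misses the last points, the out-neighbours of the last point of `X` make up for the
overlap of `X` and `Y`. -/
theorem SemiDense.card_add_card_le_of_left (h : SemiDense G N s) {X Y : Finset ℕ}
    (hXY : ∀ x ∈ X, ∀ y ∈ Y, ¬ G x y) (hX : ∀ x ∈ X, x + (6 * s + 2) < N)
    (hY : Y ⊆ Finset.range N) : X.card + Y.card ≤ N := by
  rcases X.eq_empty_or_nonempty with rfl | hne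
  · simpa using Finset.card_le_card hY
  set x := X.max' hne with hx
  have hxX : x ∈ X := X.max'_mem hne
  have hxN := hX x hxX
  have h1 := h.card_right hXY hxX (show x ≤ N - 1 by omega) (by omega)
  have h2 := h.card_add_card_le (X := X) (Y := Y.filter fun t => t ≤ x) (a := 0) (b := x + 1)
    (fun a ha b hb => hXY a ha b (Finset.mem_filter.1 hb).1) (by omega)
    (fun t ht => Finset.mem_Ico.2 ⟨Nat.zero_le _, Nat.lt_succ_of_le (X.le_max' t ht)⟩)
    (fun t ht => Finset.mem_Ico.2 ⟨Nat.zero_le _, Nat.lt_succ_of_le (Finset.mem_filter.1 ht).2⟩)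
  have h3 : Y.card ≤ (Y.filter fun t => t ≤ x).card +
      (Y.filter fun t => x < t ∧ t ≤ N - 1).card := by
    refine (Finset.card_le_card fun t ht => ?_).trans (Finset.card_union_le _ _)
    have := Finset.mem_range.1 (hY ht)
    simp only [Finset.mem_union, Finset.mem_filter, ht, true_and]
    omega
  omega

theorem SemiDense.card_add_card_le_of_right (h : SemiDense G N s) {X Y : Finset ℕ}
    (hXY : ∀ x ∈ X, ∀ y ∈ Y, ¬ G x y) (hY : ∀ y ∈ Y, 6 * s + 2 ≤ y ∧ y < N)
    (hX : X ⊆ Finset.range N) : X.card + Y.card ≤ N := by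
  rcases Y.eq_empty_or_nonempty with rfl | hne
  · simpa using Finset.card_le_card hX
  set y := Y.min' hne with hy
  have hyY : y ∈ Y := Y.min'_mem hne
  have hyN := hY y hyY
  have h1 := h.card_left hXY hyY (Nat.zero_le y) (by omega)
  have h2 := h.card_add_card_le (X := X.filter fun t => y ≤ t) (Y := Y) (a := y) (b := N)
    (fun a ha b hb => hXY a (Finset.mem_filter.1 ha).1 b hb) le_rfl
    (fun t ht => Finset.mem_Ico.2 ⟨(Finset.mem_filter.1 ht).2,
      Finset.mem_range.1 (hX (Finset.mem_filter.1 ht).1)⟩)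
    (fun t ht => Finset.mem_Ico.2 ⟨Y.min'_le t ht, (hY t ht).2⟩)
  have h3 : X.card ≤ (X.filter fun t => y ≤ t).card +
      (X.filter fun t => 0 ≤ t ∧ t < y).card := by
    refine (Finset.card_le_card fun t ht => ?_).trans (Finset.card_union_le _ _)
    simp only [Finset.mem_union, Finset.mem_filter, ht, true_and]
    omega
  omega

/-- A matching between out-copies and in-copies of the points, using arcs of `G`, that covers every
out-copy except the last `m` ones and every in-copy except the first `m` ones. It is a perfect
matching of the bipartite graph in which `m` dummies on either side take care of the exceptions. -/
theorem SemiDense.exists_matching (h : SemiDense G N s) {m : ℕ} (hm : 6 * s + 2 ≤ m) :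
    ∃ M : Finset (ℕ × ℕ), M.card ≤ N ∧ (∀ e ∈ M, G e.1 e.2 ∧ e.1 < N ∧ e.2 < N) ∧
      (∀ i, (M.filter fun e => e.1 = i).card ≤ 1) ∧ (∀ j, (M.filter fun e => e.2 = j).card ≤ 1) ∧
      (∀ i, i + m < N → ∃ e ∈ M, e.1 = i) ∧ ∀ j, m ≤ j → j < N → ∃ e ∈ M, e.2 = j := by
  let R : Fin N ⊕ Fin m → Fin N ⊕ Fin m → Prop := fun x y =>
    Sum.elim (fun i : Fin N => Sum.elim (fun j : Fin N => G i j) (fun _ => N ≤ i.val + m) y)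
      (fun _ => Sum.elim (fun j : Fin N => j.val < m) (fun _ => True) y) x
  have hall : ∀ 𝒜 : Finset (Fin N ⊕ Fin m),
      𝒜.card ≤ (Finset.univ.filter fun y => ∃ x ∈ 𝒜, R x y).card := by
    intro 𝒜
    set I := Finset.univ.filter fun y => ∃ x ∈ 𝒜, R x y with hI
    rw [← Finset.card_toLeft_add_card_toRight (u := 𝒜),
      ← Finset.card_toLeft_add_card_toRight (u := I)]
    set X := 𝒜.toLeft.map Fin.valEmbedding with hXdef
    set Y := (I.toLeftᶜ).map Fin.valEmbedding with hYdef
    have hXc : X.card = 𝒜.toLeft.card := Finset.card_map _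
    have hYc : Y.card + I.toLeft.card = N := by
      rw [hYdef, Finset.card_map, Finset.card_compl_add_card, Fintype.card_fin]
    have hmemI : ∀ j : Fin N, ∀ x ∈ 𝒜, R x (Sum.inl j) → j ∈ I.toLeft := fun j x hx hR => by
      simp only [Finset.mem_toLeft, hI, Finset.mem_filter, Finset.mem_univ, true_and]
      exact ⟨x, hx, hR⟩
    have hXY : ∀ x ∈ X, ∀ y ∈ Y, ¬ G x y := by
      intro x hx y hy hG
      obtain ⟨i, hi, rfl⟩ := Finset.mem_map.1 hx
      obtain ⟨j, hj, rfl⟩ := Finset.mem_map.1 hy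
      exact Finset.mem_compl.1 hj (hmemI j (Sum.inl i) (by simpa using hi) hG)
    have hXN : X ⊆ Finset.range N := fun x hx => by
      obtain ⟨i, -, rfl⟩ := Finset.mem_map.1 hx
      exact Finset.mem_range.2 i.2
    have hYN : Y ⊆ Finset.range N := fun y hy => by
      obtain ⟨j, -, rfl⟩ := Finset.mem_map.1 hy
      exact Finset.mem_range.2 j.2
    have hDm : 𝒜.toRight.card ≤ m := by simpa using Finset.card_le_univ 𝒜.toRight
    rcases 𝒜.toRight.eq_empty_or_nonempty with hD | ⟨d, hd⟩
    · rw [hD, Finset.card_empty]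
      by_cases hlast : ∃ i ∈ 𝒜.toLeft, N ≤ i.val + m
      · obtain ⟨i, hi, him⟩ := hlast
        have hright : I.toRight = Finset.univ := by
          ext e
          simp only [Finset.mem_toRight, hI, Finset.mem_filter, Finset.mem_univ, true_and, iff_true]
          exact ⟨Sum.inl i, by simpa using hi, him⟩
        have := h.card_add_card_le hXY (a := 0) le_rfl (by simpa using hXN) (by simpa using hYN)
        rw [hright, Finset.card_univ, Fintype.card_fin]
        omega
      · push Not at hlast
        have := h.card_add_card_le_of_left hXY (fun x hx => by
          obtain ⟨i, hi, rfl⟩ := Finset.mem_map.1 hx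
          have := hlast i hi
          simp only [Fin.valEmbedding_apply]
          omega) hYN
        omega
    · have hright : I.toRight = Finset.univ := by
        ext e
        simp only [Finset.mem_toRight, hI, Finset.mem_filter, Finset.mem_univ, true_and, iff_true]
        exact ⟨Sum.inr d, by simpa using hd, trivial⟩
      have := h.card_add_card_le_of_right hXY (fun y hy => by
        obtain ⟨j, hj, rfl⟩ := Finset.mem_map.1 hy
        refine ⟨?_, j.2⟩
        by_contra! hlt
        refine Finset.mem_compl.1 hj (hmemI j (Sum.inr d) (by simpa using hd) ?_)
        change j.val < m
        exact lt_of_lt_of_le hlt hm) hXN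
      rw [hright, Finset.card_univ, Fintype.card_fin]
      omega
  obtain ⟨f, hf, hfR⟩ := (Fintype.all_card_le_filter_rel_iff_exists_injective R).1 hall
  have hsurj : Function.Surjective f := Finite.surjective_of_injective hf
  let P : Finset (Fin N × Fin N) := Finset.univ.filter fun e => f (Sum.inl e.1) = Sum.inl e.2
  have hP1 : ∀ e ∈ P, ∀ e' ∈ P, e.1 = e'.1 → e = e' := by
    intro e he e' he' h1
    have h2 := (Finset.mem_filter.1 he).2
    rw [h1, (Finset.mem_filter.1 he').2] at h2
    exact Prod.ext h1 (Sum.inl.inj h2).symm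
  have hP2 : ∀ e ∈ P, ∀ e' ∈ P, e.2 = e'.2 → e = e' := by
    intro e he e' he' h1
    have h2 := (Finset.mem_filter.1 he).2
    rw [h1, ← (Finset.mem_filter.1 he').2] at h2
    exact Prod.ext (Sum.inl.inj (hf h2)) h1
  have himg : ∀ e : ℕ × ℕ, e ∈ P.image (fun e => (e.1.val, e.2.val)) →
      ∃ e' ∈ P, e = (e'.1.val, e'.2.val) := fun e he => by
    obtain ⟨e', he', rfl⟩ := Finset.mem_image.1 he
    exact ⟨e', he', rfl⟩
  refine ⟨P.image fun e => (e.1.val, e.2.val), ?_, ?_, ?_, ?_, ?_, ?_⟩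
  · refine Finset.card_image_le.trans ?_
    have := Finset.card_le_card_of_injOn (s := P) (t := (Finset.univ : Finset (Fin N)))
      (fun e => e.1) (fun _ _ => Finset.mem_univ _) (fun e he e' he' h1 => hP1 e he e' he' h1)
    simpa using this
  · intro e he
    obtain ⟨e', he', rfl⟩ := himg e he
    have := hfR (Sum.inl e'.1)
    rw [(Finset.mem_filter.1 he').2] at this
    exact ⟨this, e'.1.2, e'.2.2⟩
  · intro i
    refine Finset.card_le_one.2 fun e he e' he' => ?_
    rw [Finset.mem_filter] at he he'
    obtain ⟨d, hd, rfl⟩ := himg e he.1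
    obtain ⟨d', hd', rfl⟩ := himg e' he'.1
    rw [hP1 d hd d' hd' (Fin.ext (he.2.trans he'.2.symm))]
  · intro i
    refine Finset.card_le_one.2 fun e he e' he' => ?_
    rw [Finset.mem_filter] at he he'
    obtain ⟨d, hd, rfl⟩ := himg e he.1
    obtain ⟨d', hd', rfl⟩ := himg e' he'.1
    rw [hP2 d hd d' hd' (Fin.ext (he.2.trans he'.2.symm))]
  · intro i hi
    have := hfR (Sum.inl (⟨i, by omega⟩ : Fin N))
    rcases hfi : f (Sum.inl (⟨i, by omega⟩ : Fin N)) with j | e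
    · exact ⟨(i, j.val), Finset.mem_image.2 ⟨(⟨i, by omega⟩, j),
        Finset.mem_filter.2 ⟨Finset.mem_univ _, hfi⟩, rfl⟩, rfl⟩
    · rw [hfi] at this
      simp only [R, Sum.elim_inl, Sum.elim_inr] at this
      omega
  · intro j hj hjN
    obtain ⟨x, hx⟩ := hsurj (Sum.inl (⟨j, hjN⟩ : Fin N))
    rcases x with i | d
    · exact ⟨(i.val, j), Finset.mem_image.2 ⟨(i, ⟨j, hjN⟩),
        Finset.mem_filter.2 ⟨Finset.mem_univ _, hx⟩, rfl⟩, rfl⟩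
    · have := hfR (Sum.inr d)
      rw [hx] at this
      simp only [R, Sum.elim_inl, Sum.elim_inr] at this
      omega

/-- The union of `q` successive arc-disjoint matchings. -/
theorem SemiDense.exists_regular {s₀ m : ℕ} (h : SemiDense G N s₀) (q : ℕ)
    (hm : 6 * (s₀ + q) ≤ m + 4) :
    ∃ H : Finset (ℕ × ℕ), H.card ≤ q * N ∧ (∀ e ∈ H, G e.1 e.2 ∧ e.1 < N ∧ e.2 < N) ∧
      (∀ i, (H.filter fun e => e.1 = i).card ≤ q) ∧ (∀ j, (H.filter fun e => e.2 = j).card ≤ q) ∧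
      (∀ i, i + m < N → q ≤ (H.filter fun e => e.1 = i).card) ∧
      ∀ j, m ≤ j → j < N → q ≤ (H.filter fun e => e.2 = j).card := by
  induction q with
  | zero => exact ⟨∅, by simp, by simp, by simp, by simp, by simp, by simp⟩
  | succ q ih =>
    obtain ⟨H, hc, hH, ho, hi, ho', hi'⟩ := ih (by omega)
    obtain ⟨G', hG'⟩ : ∃ G' : ℕ → ℕ → Prop, ∀ i j, G' i j ↔ G i j ∧ (i, j) ∉ H :=
      ⟨fun i j => G i j ∧ (i, j) ∉ H, fun _ _ => Iff.rfl⟩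
    have hG : SemiDense G' N (s₀ + q) := by
      intro i j hij hj
      obtain ⟨h1, h2⟩ := h i j hij hj
      constructor
      · have : ((Finset.Ioc i j).filter (G i)).card ≤
            ((Finset.Ioc i j).filter (G' i)).card +
              (H.filter fun e => e.1 = i).card := by
          rw [← Finset.card_image_of_injective (H.filter fun e => e.1 = i) Prod.swap_injective,
            ← Finset.card_image_of_injective ((Finset.Ioc i j).filter (G i))
              (f := fun t => (t, i)) (fun a b hab => (Prod.ext_iff.1 hab).1),
            ← Finset.card_image_of_injective
              ((Finset.Ioc i j).filter (G' i))
              (f := fun t => (t, i)) (fun a b hab => (Prod.ext_iff.1 hab).1)]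
          refine (Finset.card_le_card fun e he => ?_).trans (Finset.card_union_le _ _)
          obtain ⟨t, ht, rfl⟩ := Finset.mem_image.1 he
          rw [Finset.mem_filter] at ht
          by_cases htH : (i, t) ∈ H
          · exact Finset.mem_union_right _ (Finset.mem_image.2
              ⟨(i, t), Finset.mem_filter.2 ⟨htH, rfl⟩, rfl⟩)
          · exact Finset.mem_union_left _ (Finset.mem_image.2
              ⟨t, Finset.mem_filter.2 ⟨ht.1, (hG' _ _).2 ⟨ht.2, htH⟩⟩, rfl⟩)
        have := ho i
        omega
      · have : ((Finset.Ico i j).filter fun t => G t j).card ≤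
            ((Finset.Ico i j).filter fun t => G' t j).card +
              (H.filter fun e => e.2 = j).card := by
          rw [← Finset.card_image_of_injective ((Finset.Ico i j).filter fun t => G t j)
              (f := fun t => (t, j)) (fun a b hab => (Prod.ext_iff.1 hab).1),
            ← Finset.card_image_of_injective
              ((Finset.Ico i j).filter fun t => G' t j)
              (f := fun t => (t, j)) (fun a b hab => (Prod.ext_iff.1 hab).1)]
          refine (Finset.card_le_card fun e he => ?_).trans (Finset.card_union_le _ _)
          obtain ⟨t, ht, rfl⟩ := Finset.mem_image.1 he
          rw [Finset.mem_filter] at ht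
          by_cases htH : (t, j) ∈ H
          · exact Finset.mem_union_right _ (Finset.mem_filter.2 ⟨htH, rfl⟩)
          · exact Finset.mem_union_left _ (Finset.mem_image.2
              ⟨t, Finset.mem_filter.2 ⟨ht.1, (hG' _ _).2 ⟨ht.2, htH⟩⟩, rfl⟩)
        have := hi j
        omega
    obtain ⟨M, hMc, hM, hMo, hMi, hMo', hMi'⟩ := hG.exists_matching (m := m) (by omega)
    have hdisj : Disjoint H M := by
      rw [Finset.disjoint_left]
      exact fun e he he' => ((hG' _ _).1 (hM e he').1).2 he
    have hcard : ∀ (P : ℕ × ℕ → Prop) [DecidablePred P], ((H ∪ M).filter P).card =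
        (H.filter P).card + (M.filter P).card := by
      intro P _
      rw [Finset.filter_union, Finset.card_union_of_disjoint
        (hdisj.mono (Finset.filter_subset _ _) (Finset.filter_subset _ _))]
    refine ⟨H ∪ M, ?_, ?_, ?_, ?_, ?_, ?_⟩
    · rw [Finset.card_union_of_disjoint hdisj, add_mul, one_mul]
      omega
    · intro e he
      rcases Finset.mem_union.1 he with he | he
      · exact hH e he
      · exact ⟨((hG' _ _).1 (hM e he).1).1, (hM e he).2⟩
    · intro i
      rw [hcard]
      exact Nat.add_le_add (ho i) (hMo i)
    · intro j
      rw [hcard]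
      exact Nat.add_le_add (hi j) (hMi j)
    · intro i hi
      rw [hcard]
      obtain ⟨e, he, hei⟩ := hMo' i hi
      exact Nat.add_le_add (ho' i hi) (Finset.card_pos.2 ⟨e, Finset.mem_filter.2 ⟨he, hei⟩⟩)
    · intro j hj hjN
      rw [hcard]
      obtain ⟨e, he, hei⟩ := hMi' j hj hjN
      exact Nat.add_le_add (hi' j hj hjN) (Finset.card_pos.2 ⟨e, Finset.mem_filter.2 ⟨he, hei⟩⟩)

end Matching

/-- A set `C` of vertices of a tournament carries an acyclic digraph with at most `q * C.card` arcs,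
avoiding a prescribed set of arcs with at most `s` arcs at each vertex in either direction, in which
all but `m` vertices have out-degree at least `q` and all but `m` vertices have in-degree at
least `q`. -/
theorem TournamentRel.exists_acyclic_regular {V : Type*} [Inhabited V] {r : V → V → Prop}
    (hr : TournamentRel r) (C : Finset V) (forb : Finset (V × V)) {s m q : ℕ}
    (ho : ∀ u, (forb.filter fun e => e.1 = u).card ≤ s)
    (hi : ∀ u, (forb.filter fun e => e.2 = u).card ≤ s) (hm : 6 * (s + q) ≤ m + 4) :
    ∃ (H : Finset (V × V)) (pos : V → ℕ) (Fo Fi : Finset V), H.card ≤ q * C.card ∧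
      Fo.card ≤ m ∧ Fi.card ≤ m ∧ Fo ⊆ C ∧ Fi ⊆ C ∧ (∀ u ∈ C, pos u < C.card) ∧
      (∀ e ∈ H, r e.1 e.2 ∧ e.1 ∈ C ∧ e.2 ∈ C ∧ e ∉ forb ∧ pos e.1 < pos e.2) ∧
      (∀ u ∈ C, u ∉ Fo → ∃ K : Finset V, K.card = q ∧ ∀ z ∈ K, (u, z) ∈ H) ∧
      ∀ u ∈ C, u ∉ Fi → ∃ K : Finset V, K.card = q ∧ ∀ z ∈ K, (z, u) ∈ H := by
  obtain ⟨v, hvC, hinj, hsurj, hmed⟩ := hr.exists_median_order C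
  obtain ⟨G, hGdef⟩ : ∃ G : ℕ → ℕ → Prop, ∀ i j, G i j ↔
      (r (v i) (v j) ∧ (v i, v j) ∉ forb) ∧ i < j := ⟨_, fun _ _ => Iff.rfl⟩
  have hG : SemiDense G C.card s := by
    intro i j hij hj
    obtain ⟨h1, h2⟩ := hmed i j hij hj
    constructor
    · have : ((Finset.Ioc i j).filter fun t => r (v i) (v t)).card ≤
          ((Finset.Ioc i j).filter (G i)).card +
            (forb.filter fun e => e.1 = v i).card := by
        have hle : ((Finset.Ioc i j).filter fun t => (v i, v t) ∈ forb).card ≤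
            (forb.filter fun e => e.1 = v i).card := by
          refine Finset.card_le_card_of_injOn (fun t => (v i, v t))
            (fun t ht => ?_) fun t ht t' ht' heq => ?_
          · exact Finset.mem_filter.2 ⟨(Finset.mem_filter.1 ht).2, rfl⟩
          · have ht := Finset.mem_Ioc.1 (Finset.mem_filter.1 ht).1
            have ht' := Finset.mem_Ioc.1 (Finset.mem_filter.1 ht').1
            exact hinj t (by omega) t' (by omega) (Prod.ext_iff.1 heq).2
        refine le_trans ?_ (Nat.add_le_add_left hle _)
        refine (Finset.card_le_card fun t ht => ?_).trans (Finset.card_union_le _ _)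
        rw [Finset.mem_filter] at ht
        simp only [Finset.mem_union, Finset.mem_filter, hGdef, ht.1, ht.2, (Finset.mem_Ioc.1 ht.1).1]
        tauto
      have := ho (v i)
      omega
    · have : ((Finset.Ico i j).filter fun t => r (v t) (v j)).card ≤
          ((Finset.Ico i j).filter fun t => G t j).card +
            (forb.filter fun e => e.2 = v j).card := by
        have hle : ((Finset.Ico i j).filter fun t => (v t, v j) ∈ forb).card ≤
            (forb.filter fun e => e.2 = v j).card := by
          refine Finset.card_le_card_of_injOn (fun t => (v t, v j))
            (fun t ht => ?_) fun t ht t' ht' heq => ?_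
          · exact Finset.mem_filter.2 ⟨(Finset.mem_filter.1 ht).2, rfl⟩
          · have ht := Finset.mem_Ico.1 (Finset.mem_filter.1 ht).1
            have ht' := Finset.mem_Ico.1 (Finset.mem_filter.1 ht').1
            exact hinj t (by omega) t' (by omega) (Prod.ext_iff.1 heq).1
        refine le_trans ?_ (Nat.add_le_add_left hle _)
        refine (Finset.card_le_card fun t ht => ?_).trans (Finset.card_union_le _ _)
        rw [Finset.mem_filter] at ht
        simp only [Finset.mem_union, Finset.mem_filter, hGdef, ht.1, ht.2, (Finset.mem_Ico.1 ht.1).2]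
        tauto
      have := hi (v j)
      omega
  obtain ⟨H, hc, hH, -, -, hout, hin⟩ := hG.exists_regular q hm
  choose! pos hposlt hpos using hsurj
  have hposv : ∀ i < C.card, pos (v i) = i := fun i hilt =>
    hinj _ (hposlt _ (hvC i hilt)) _ hilt (hpos _ (hvC i hilt))
  refine ⟨H.image fun e => (v e.1, v e.2), pos,
    ((Finset.range C.card).filter fun i => C.card ≤ i + m).image v,
    ((Finset.range C.card).filter fun i => i < m).image v, Finset.card_image_le.trans hc,
    ?_, ?_, ?_, ?_, hposlt, ?_, ?_, ?_⟩
  · refine Finset.card_image_le.trans ((Finset.card_le_card (t := Finset.Ico (C.card - m) C.card)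
      fun i hi => ?_).trans ?_)
    · rw [Finset.mem_filter, Finset.mem_range] at hi
      rw [Finset.mem_Ico]
      omega
    · rw [Nat.card_Ico]
      omega
  · refine Finset.card_image_le.trans ((Finset.card_le_card (t := Finset.range m)
      fun i hi => ?_).trans (Finset.card_range m).le)
    exact Finset.mem_range.2 (Finset.mem_filter.1 hi).2
  · intro u hu
    obtain ⟨i, hi, rfl⟩ := Finset.mem_image.1 hu
    exact hvC i (Finset.mem_range.1 (Finset.mem_filter.1 hi).1)
  · intro u hu
    obtain ⟨i, hi, rfl⟩ := Finset.mem_image.1 hu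
    exact hvC i (Finset.mem_range.1 (Finset.mem_filter.1 hi).1)
  · intro e he
    obtain ⟨d, hd, rfl⟩ := Finset.mem_image.1 he
    obtain ⟨hd', h4, h5⟩ := hH d hd
    obtain ⟨⟨h1, h2⟩, h3⟩ := (hGdef _ _).1 hd'
    exact ⟨h1, hvC _ h4, hvC _ h5, h2, by simpa only [hposv _ h4, hposv _ h5] using h3⟩
  · intro u hu hFo
    have hlt : pos u + m < C.card := by
      by_contra! hge
      exact hFo (Finset.mem_image.2 ⟨pos u, Finset.mem_filter.2
        ⟨Finset.mem_range.2 (hposlt u hu), hge⟩, hpos u hu⟩)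
    have hcard := hout _ hlt
    have hcard' : q ≤ ((H.filter fun e => e.1 = pos u).image fun e => v e.2).card := by
      rw [Finset.card_image_of_injOn]
      · exact hcard
      · intro e he e' he' heq
        rw [Finset.mem_coe, Finset.mem_filter] at he he'
        exact Prod.ext (he.2.trans he'.2.symm)
          (hinj _ (hH e he.1).2.2 _ (hH e' he'.1).2.2 heq)
    obtain ⟨K, hK, hKc⟩ := Finset.exists_subset_card_eq hcard'
    refine ⟨K, hKc, fun z hz => ?_⟩
    obtain ⟨e, he, rfl⟩ := Finset.mem_image.1 (hK hz)
    rw [Finset.mem_filter] at he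
    refine Finset.mem_image.2 ⟨e, he.1, ?_⟩
    rw [he.2, hpos u hu]
  · intro u hu hFi
    have hlt : m ≤ pos u := by
      by_contra! hge
      exact hFi (Finset.mem_image.2 ⟨pos u, Finset.mem_filter.2
        ⟨Finset.mem_range.2 (hposlt u hu), hge⟩, hpos u hu⟩)
    have hcard := hin _ hlt (hposlt u hu)
    have hcard' : q ≤ ((H.filter fun e => e.2 = pos u).image fun e => v e.1).card := by
      rw [Finset.card_image_of_injOn]
      · exact hcard
      · intro e he e' he' heq
        rw [Finset.mem_coe, Finset.mem_filter] at he he'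
        exact Prod.ext (hinj _ (hH e he.1).2.1 _ (hH e' he'.1).2.1 heq)
          (he.2.trans he'.2.symm)
    obtain ⟨K, hK, hKc⟩ := Finset.exists_subset_card_eq hcard'
    refine ⟨K, hKc, fun z hz => ?_⟩
    obtain ⟨e, he, rfl⟩ := Finset.mem_image.1 (hK hz)
    rw [Finset.mem_filter] at he
    refine Finset.mem_image.2 ⟨e, he.1, ?_⟩
    rw [he.2, hpos u hu]

/-! ### Dominating sets and the terminal part of the digraph -/

section Dominating

variable {V : Type*} [Fintype V] {r : V → V → Prop}

/-- Around any vertex `v` there is a set `B` of at most `c + 1` vertices, one of which is dominated by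
all the others. The number of vertices outside `Q` without an out-neighbour in `B` is at most the
out-degree of `v` divided by `2 ^ c`: each new member of `B` is a vertex of large in-degree among the
vertices not dealt with so far. -/
theorem TournamentRel.exists_dominating_set (hr : TournamentRel r) (Q : Finset V) {v : V}
    (hv : v ∉ Q) (c : ℕ) :
    ∃ (B : Finset V) (b : V), v ∈ B ∧ b ∈ B ∧ Disjoint B Q ∧ B.card ≤ c + 1 ∧
      (∀ u ∈ B, u ≠ b → r u b) ∧
      (Finset.univ.filter fun y => y ∉ B ∧ y ∉ Q ∧ ∀ u ∈ B, ¬ r y u).card * 2 ^ c ≤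
        (Finset.univ.filter (r v)).card := by
  induction c with
  | zero =>
    refine ⟨{v}, v, by simp, by simp, by simpa using hv, by simp, by simp, ?_⟩
    rw [pow_zero, mul_one]
    refine Finset.card_le_card fun y hy => ?_
    simp only [Finset.mem_filter, Finset.mem_univ, true_and, Finset.mem_singleton,
      forall_eq] at hy ⊢
    exact (hr.or hy.1).resolve_left hy.2.2
  | succ c ih =>
    obtain ⟨B, b, hvB, hbB, hd, hc, hsink, hU⟩ := ih
    set U := Finset.univ.filter fun y => y ∉ B ∧ y ∉ Q ∧ ∀ u ∈ B, ¬ r y u with hUdef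
    rcases U.eq_empty_or_nonempty with hne | hne
    · refine ⟨B, b, hvB, hbB, hd, by omega, hsink, ?_⟩
      rw [← hUdef, hne]
      simp
    obtain ⟨u, hu, hdeg⟩ := hr.exists_in_ge hne
    have hu' := (Finset.mem_filter.1 hu).2
    have hsum := hr.card_out_add_card_in U hu
    refine ⟨insert u B, u, Finset.mem_insert_of_mem hvB, Finset.mem_insert_self _ _, ?_, ?_, ?_, ?_⟩
    · rw [Finset.disjoint_insert_left]
      exact ⟨hu'.2.1, hd⟩
    · exact (Finset.card_insert_le _ _).trans (by omega)
    · intro w hw hne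
      have hwB := (Finset.mem_insert.1 hw).resolve_left hne
      exact (hr.or hne).resolve_right (hu'.2.2 w hwB)
    · have hsub : (Finset.univ.filter fun y => y ∉ insert u B ∧ y ∉ Q ∧ ∀ w ∈ insert u B, ¬ r y w) ⊆
          U.filter (r u) := by
        intro y hy
        simp only [Finset.mem_filter, Finset.mem_univ, true_and, Finset.mem_insert, not_or,
          forall_eq_or_imp, hUdef] at hy ⊢
        obtain ⟨⟨hyu, hyB⟩, hyQ, hnu, hnB⟩ := hy
        exact ⟨⟨hyB, hyQ, hnB⟩, (hr.or hyu).resolve_left hnu⟩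
      calc _ ≤ (U.filter (r u)).card * 2 ^ (c + 1) := Nat.mul_le_mul_right _ (Finset.card_le_card hsub)
        _ = (2 * (U.filter (r u)).card) * 2 ^ c := by ring
        _ ≤ U.card * 2 ^ c := Nat.mul_le_mul_right _ (by omega)
        _ ≤ _ := hU

/-- Disjoint dominating sets around all the vertices of `A`. -/
theorem TournamentRel.exists_dominating_family (hr : TournamentRel r) {A Q : Finset V}
    (hAQ : Disjoint A Q) (c : ℕ) :
    ∃ (B : V → Finset V) (b : V → V), ∀ i ∈ A, i ∈ B i ∧ b i ∈ B i ∧ Disjoint (B i) Q ∧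
      (B i).card ≤ c + 1 ∧ (∀ u ∈ B i, u ≠ b i → r u (b i)) ∧
      (∀ j ∈ A, j ≠ i → Disjoint (B i) (B j)) ∧
      (Finset.univ.filter fun y => y ∉ Q ∧ (∀ j ∈ A, y ∉ B j) ∧ ∀ u ∈ B i, ¬ r y u).card * 2 ^ c ≤
        (Finset.univ.filter (r i)).card := by
  have key : ∀ J ⊆ A, ∃ (B : V → Finset V) (b : V → V), ∀ i ∈ J, i ∈ B i ∧ b i ∈ B i ∧
      Disjoint (B i) Q ∧ (B i).card ≤ c + 1 ∧ (∀ u ∈ B i, u ≠ b i → r u (b i)) ∧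
      (∀ j ∈ J, j ≠ i → Disjoint (B i) (B j)) ∧ (∀ j ∈ A, j ≠ i → j ∉ B i) ∧
      (Finset.univ.filter fun y => (y ∉ Q ∧ y ∉ A ∧ ∀ j ∈ J, y ∉ B j) ∧
        ∀ u ∈ B i, ¬ r y u).card * 2 ^ c ≤ (Finset.univ.filter (r i)).card := by
    intro J
    induction J using Finset.induction_on with
    | empty => exact fun _ => ⟨fun _ => ∅, id, by simp⟩
    | insert i J hiJ ih =>
      intro hJ
      rw [Finset.insert_subset_iff] at hJ
      obtain ⟨B, b, hB⟩ := ih hJ.2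
      obtain ⟨B', b', hi, hb', hd, hc, hsink, hU⟩ := hr.exists_dominating_set
        (Q ∪ A.erase i ∪ J.biUnion B) (v := i) (by
          simp only [Finset.mem_union, Finset.mem_erase, Finset.mem_biUnion, ne_eq,
            not_true_eq_false, false_and, or_false, not_or, not_exists, not_and]
          refine ⟨Finset.disjoint_left.1 hAQ hJ.1, fun j hj => ?_⟩
          exact (hB j hj).2.2.2.2.2.2.1 i hJ.1 fun e => hiJ (e ▸ hj)) c
      rw [Finset.disjoint_union_right, Finset.disjoint_union_right,
        Finset.disjoint_biUnion_right] at hd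
      have hne : ∀ j ∈ J, j ≠ i := fun j hj e => hiJ (e ▸ hj)
      refine ⟨fun j => if j = i then B' else B j, fun j => if j = i then b' else b j, ?_⟩
      intro j hj
      by_cases hji : j = i
      · subst hji
        simp only [if_true]
        refine ⟨hi, hb', hd.1.1, hc, hsink, fun l hl hlj => ?_, fun l hl hlj => ?_, ?_⟩
        · rw [if_neg hlj]
          exact hd.2 l ((Finset.mem_insert.1 hl).resolve_left hlj)
        · exact fun hmem => Finset.disjoint_left.1 hd.1.2 hmem (Finset.mem_erase.2 ⟨hlj, hl⟩)
        · refine le_trans (Nat.mul_le_mul_right _ (Finset.card_le_card fun y hy => ?_)) hU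
          simp only [Finset.mem_filter, Finset.mem_univ, true_and] at hy ⊢
          obtain ⟨⟨h1, h2, h3⟩, h4⟩ := hy
          refine ⟨by simpa using h3 j (Finset.mem_insert_self _ _), ?_, h4⟩
          simp only [Finset.mem_union, Finset.mem_erase, Finset.mem_biUnion, not_or, not_exists,
            not_and]
          refine ⟨⟨h1, fun _ => h2⟩, fun l hl => ?_⟩
          simpa [hne l hl] using h3 l (Finset.mem_insert_of_mem hl)
      · have hjJ := (Finset.mem_insert.1 hj).resolve_left hji
        obtain ⟨g1, g2, g3, g4, g5, g6, g7, g8⟩ := hB j hjJ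
        simp only [if_neg hji]
        refine ⟨g1, g2, g3, g4, g5, fun l hl hlj => ?_, g7, ?_⟩
        · by_cases hli : l = i
          · rw [if_pos hli]
            exact (hd.2 j hjJ).symm
          · rw [if_neg hli]
            exact g6 l ((Finset.mem_insert.1 hl).resolve_left hli) hlj
        · refine le_trans (Nat.mul_le_mul_right _ (Finset.card_le_card fun y hy => ?_)) g8
          simp only [Finset.mem_filter, Finset.mem_univ, true_and] at hy ⊢
          obtain ⟨⟨h1, h2, h3⟩, h4⟩ := hy
          refine ⟨⟨h1, h2, fun l hl => ?_⟩, h4⟩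
          simpa [hne l hl] using h3 l (Finset.mem_insert_of_mem hl)
  obtain ⟨B, b, hB⟩ := key A subset_rfl
  refine ⟨B, b, fun i hi => ?_⟩
  obtain ⟨g1, g2, g3, g4, g5, g6, -, g8⟩ := hB i hi
  refine ⟨g1, g2, g3, g4, g5, g6, le_trans (Nat.mul_le_mul_right _
    (Finset.card_le_card fun y hy => ?_)) g8⟩
  simp only [Finset.mem_filter, Finset.mem_univ, true_and] at hy ⊢
  exact ⟨⟨hy.1, fun hyA => hy.2.1 y hyA (hB y hyA).1, hy.2.1⟩, hy.2.2⟩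

/-- The terminal part of the digraph. There are `3 * k` disjoint dominating sets `B i`, and `k` of
their sinks, forming `X`, are dominated by at least `k` other sinks each. So a vertex with an
out-neighbour in every `B i` reaches each remaining vertex of `X` after any deletion of fewer than
`k` vertices. Only the vertices of the small set `Ex` miss some `B i`. -/
theorem TournamentRel.exists_terminal (hr : TournamentRel r) {k c M : ℕ} {A Q : Finset V}
    (hA : A.card = 3 * k) (hAQ : Disjoint A Q) (hM : ∀ i ∈ A, (Finset.univ.filter (r i)).card ≤ M) :
    ∃ (B : V → Finset V) (X Ex : Finset V) (E : Finset (V × V)), A ⊆ A.biUnion B ∧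
      Disjoint (A.biUnion B) Q ∧ (A.biUnion B).card ≤ 3 * k * (c + 1) ∧ X ⊆ A.biUnion B ∧
      X.card = k ∧
      E.card ≤ 3 * k * (c + 1) + 9 * k ^ 2 ∧ (∀ e ∈ E, r e.1 e.2) ∧
      (∀ D : V → V → Prop, (∀ e ∈ E, D e.1 e.2) → ∀ S : Finset V, S.card < k → ∀ v, v ∉ S →
        (∀ i ∈ A, ∃ u ∈ B i, D v u) → ∀ x ∈ X, x ∉ S → Reach D S v x) ∧
      (∀ y, y ∉ Q → y ∉ A.biUnion B → y ∉ Ex → ∀ i ∈ A, ∃ u ∈ B i, r y u) ∧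
      Ex.card * 2 ^ c ≤ 3 * k * M ∧ (Ex.Nonempty → 2 ^ c ≤ M) := by
  obtain ⟨B, b, hB⟩ := hr.exists_dominating_family hAQ c
  have hbinj : Set.InjOn b A := by
    intro i hi j hj hij
    by_contra hne
    refine Finset.disjoint_left.1 ((hB i hi).2.2.2.2.2.1 j hj (Ne.symm hne)) (hB i hi).2.1 ?_
    rw [hij]
    exact (hB j hj).2.1
  have hUc : (A.image b).card = 3 * k := by rw [Finset.card_image_of_injOn hbinj, hA]
  obtain ⟨X, hXU, hXc, hX⟩ := hr.exists_large_inDegree (U := A.image b) (k := k) hUc.ge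
  have hUsub : A.image b ⊆ A.biUnion B := fun x hx => by
    obtain ⟨i, hi, rfl⟩ := Finset.mem_image.1 hx
    exact Finset.mem_biUnion.2 ⟨i, hi, (hB i hi).2.1⟩
  have hcard : (A.biUnion B).card ≤ 3 * k * (c + 1) := by
    rw [← hA]
    exact Finset.card_biUnion_le_card_mul _ _ _ fun i hi => (hB i hi).2.2.2.1
  let Exi : V → Finset V := fun i =>
    Finset.univ.filter fun y => y ∉ Q ∧ (∀ j ∈ A, y ∉ B j) ∧ ∀ u ∈ B i, ¬ r y u
  have hExi : ∀ i ∈ A, (Exi i).card * 2 ^ c ≤ M := fun i hi =>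
    (hB i hi).2.2.2.2.2.2.trans (hM i hi)
  refine ⟨B, X, A.biUnion Exi,
    (A.biUnion fun i => ((B i).erase (b i)).image fun u => (u, b i)) ∪
      ((A.image b) ×ˢ (A.image b)).filter (fun e => r e.1 e.2), ?_, ?_, hcard, hXU.trans hUsub, hXc,
      ?_, ?_, ?_, ?_, ?_, ?_⟩
  · exact fun i hi => Finset.mem_biUnion.2 ⟨i, hi, (hB i hi).1⟩
  · exact (Finset.disjoint_biUnion_left _ _ _).2 fun i hi => (hB i hi).2.2.1
  · refine (Finset.card_union_le _ _).trans (Nat.add_le_add ?_ ?_)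
    · rw [← hA]
      refine Finset.card_biUnion_le_card_mul _ _ _ fun i hi => ?_
      exact Finset.card_image_le.trans (Finset.card_erase_le.trans (hB i hi).2.2.2.1)
    · refine (Finset.card_filter_le _ _).trans ?_
      rw [Finset.card_product, hUc]
      exact (by ring : 3 * k * (3 * k) = 9 * k ^ 2).le
  · intro e he
    rcases Finset.mem_union.1 he with he | he
    · obtain ⟨i, hi, he⟩ := Finset.mem_biUnion.1 he
      obtain ⟨u, hu, rfl⟩ := Finset.mem_image.1 he
      rw [Finset.mem_erase] at hu
      exact (hB i hi).2.2.2.2.1 u hu.2 hu.1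
    · exact (Finset.mem_filter.1 he).2
  · intro D hD S hS v hvS hv x hx hxS
    obtain ⟨i, hi, hix, hclean⟩ : ∃ i ∈ A, r (b i) x ∧ ∀ u ∈ B i, u ∉ S := by
      by_contra! hcon
      have hle : k ≤ (A.filter fun i => r (b i) x).card := by
        refine (hX x hx).trans ((Finset.card_le_card fun z hz => ?_).trans
          (Finset.card_image_le (f := b)))
        obtain ⟨hz, hzx⟩ := Finset.mem_filter.1 hz
        obtain ⟨i, hi, rfl⟩ := Finset.mem_image.1 hz
        exact Finset.mem_image_of_mem _ (Finset.mem_filter.2 ⟨hi, hzx⟩)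
      choose! g hgB hgS using hcon
      have := Finset.card_le_card_of_injOn (s := A.filter fun i => r (b i) x) (t := S) g
        (fun i hi => hgS i (Finset.mem_filter.1 hi).1 (Finset.mem_filter.1 hi).2)
        (fun i hi j hj hij => by
          obtain ⟨hi, hix⟩ := Finset.mem_filter.1 hi
          obtain ⟨hj, hjx⟩ := Finset.mem_filter.1 hj
          by_contra hne
          refine Finset.disjoint_left.1 ((hB i hi).2.2.2.2.2.1 j hj (Ne.symm hne))
            (hgB i hi hix) ?_
          rw [hij]
          exact hgB j hj hjx)
      omega
    obtain ⟨u, hu, hvu⟩ := hv i hi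
    have h1 : Reach D S v u := Reach.single hvu hvS (hclean u hu)
    have h2 : Reach D S u (b i) := by
      by_cases hub : u = b i
      · rw [hub]; exact Reach.refl
      · refine Reach.single (hD (u, b i) ?_) (hclean u hu) (hclean _ (hB i hi).2.1)
        exact Finset.mem_union_left _ (Finset.mem_biUnion.2 ⟨i, hi, Finset.mem_image.2
          ⟨u, Finset.mem_erase.2 ⟨hub, hu⟩, rfl⟩⟩)
    have h3 : Reach D S (b i) x := by
      refine Reach.single (hD (b i, x) ?_) (hclean _ (hB i hi).2.1) hxS
      exact Finset.mem_union_right _ (Finset.mem_filter.2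
        ⟨Finset.mem_product.2 ⟨Finset.mem_image_of_mem _ hi, hXU hx⟩, hix⟩)
    exact (h1.trans h2).trans h3
  · intro y hyQ hyB hyEx i hi
    by_contra! hcon
    refine hyEx (Finset.mem_biUnion.2 ⟨i, hi, Finset.mem_filter.2 ⟨Finset.mem_univ _, hyQ,
      fun j hj hyj => hyB (Finset.mem_biUnion.2 ⟨j, hj, hyj⟩), hcon⟩⟩)
  · calc (A.biUnion Exi).card * 2 ^ c ≤ (∑ i ∈ A, (Exi i).card) * 2 ^ c :=
          Nat.mul_le_mul_right _ Finset.card_biUnion_le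
      _ = ∑ i ∈ A, (Exi i).card * 2 ^ c := Finset.sum_mul _ _ _
      _ ≤ ∑ _i ∈ A, M := Finset.sum_le_sum hExi
      _ = 3 * k * M := by rw [Finset.sum_const, hA, smul_eq_mul]
  · rintro ⟨y, hy⟩
    obtain ⟨i, hi, hyi⟩ := Finset.mem_biUnion.1 hy
    have h1 : 1 ≤ (Exi i).card := Finset.card_pos.2 ⟨y, hyi⟩
    exact le_trans (by simpa using Nat.mul_le_mul_right (2 ^ c) h1) (hExi i hi)

/-- The arcs that lead to the terminal part: those of a peeling of `W`, fans from the remainder of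
the peeling to the complement of `W`, and at most `m` arcs at each vertex of `F`. They bring
every vertex to `x`, provided that every vertex outside `W ∪ F` either reaches `x` or has a
successor outside `W` which is later in the order given by `pos` and does not enter `Ex`. -/
theorem TournamentRel.exists_outward_arcs (hr : TournamentRel r) {k m : ℕ}
    (hconn : RobustlyConnected k r) {A W X Ex F : Finset V} {B : V → Finset V}
    {E : Finset (V × V)} (hE : ∀ e ∈ E, r e.1 e.2)
    (hub : ∀ D : V → V → Prop, (∀ e ∈ E, D e.1 e.2) → ∀ S : Finset V, S.card < k → ∀ v, v ∉ S →
      (∀ i ∈ A, ∃ u ∈ B i, D v u) → ∀ x ∈ X, x ∉ S → Reach D S v x)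
    (hA : A.card = m) (hkm : k ≤ m) (hW : k ≤ Wᶜ.card)
    (hdom : ∀ y ∈ F, y ∉ Ex → ∀ i ∈ A, ∃ u ∈ B i, r y u)
    (hdeg : ∀ y ∈ F, y ∈ Ex → k ≤ (Finset.univ.filter fun z => r y z ∧ z ∉ W ∧ z ∉ Ex).card) :
    ∃ E' : Finset (V × V), (∀ e ∈ E', r e.1 e.2) ∧
      E'.card ≤ E.card + m * F.card + k * W.card + 2 * k * (W.card + k) ∧
      ∀ D : V → V → Prop, (∀ e ∈ E', D e.1 e.2) → ∀ S : Finset V, S.card < k →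
        ∀ x ∈ X, x ∉ S → (∀ y ∈ F, y ∉ Ex → y ∉ S → Reach D S y x) ∧
        ∀ (pos : V → ℕ) (N : ℕ), (∀ v, pos v ≤ N) →
          (∀ v, v ∉ W → v ∉ F → v ∉ S → Reach D S v x ∨ ∃ z, z ∉ S ∧ z ∉ W ∧ D v z ∧
            (z ∈ Ex → v ∈ Ex) ∧ pos v < pos z) →
          ∀ v, v ∉ S → Reach D S v x := by
  have hatt : ∀ y ∈ F, ∃ K : Finset V, K.card ≤ m ∧ (∀ z ∈ K, r y z) ∧
      ((y ∉ Ex ∧ ∀ i ∈ A, ∃ u ∈ B i, u ∈ K) ∨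
        (y ∈ Ex ∧ k ≤ K.card ∧ ∀ z ∈ K, z ∉ W ∧ z ∉ Ex)) := by
    intro y hy
    by_cases hyEx : y ∈ Ex
    · obtain ⟨K, hK, hKc⟩ := Finset.exists_subset_card_eq (hdeg y hy hyEx)
      have hK' := fun z (hz : z ∈ K) => (Finset.mem_filter.1 (hK hz)).2
      exact ⟨K, by omega, fun z hz => (hK' z hz).1, Or.inr ⟨hyEx, hKc.ge, fun z hz => (hK' z hz).2⟩⟩
    · have := hdom y hy hyEx
      choose! g hgB hgr using this
      refine ⟨A.image g, Finset.card_image_le.trans hA.le, fun z hz => ?_,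
        Or.inl ⟨hyEx, fun i hi => ⟨g i, hgB i hi, Finset.mem_image_of_mem _ hi⟩⟩⟩
      obtain ⟨i, hi, rfl⟩ := Finset.mem_image.1 hz
      exact hgr i hi
  choose! att hattc hattr hatt using hatt
  obtain ⟨P, R, τ, hRW, hRc, hPc, hPr, hP⟩ := hr.exists_peeling k W
  have hfan := fun f => hconn.exists_fan f hW
  choose Φ hΦc hΦr hΦ using hfan
  have hsub1 : ∀ e ∈ E, e ∈ E ∪ (F.biUnion fun y => (att y).image fun z => (y, z)) ∪ P ∪
      R.biUnion Φ := fun e he => by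
    simp only [Finset.mem_union]; tauto
  refine ⟨E ∪ (F.biUnion fun y => (att y).image fun z => (y, z)) ∪ P ∪ R.biUnion Φ, ?_, ?_, ?_⟩
  · intro e he
    simp only [Finset.mem_union] at he
    rcases he with ((he | he) | he) | he
    · exact hE e he
    · obtain ⟨y, hy, he⟩ := Finset.mem_biUnion.1 he
      obtain ⟨z, hz, rfl⟩ := Finset.mem_image.1 he
      exact hattr y hy z hz
    · exact hPr e he
    · obtain ⟨f, -, he⟩ := Finset.mem_biUnion.1 he
      exact hΦr f e he
  · have h1 : (F.biUnion fun y => (att y).image fun z => (y, z)).card ≤ F.card * m :=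
      Finset.card_biUnion_le_card_mul _ _ _ fun y hy => Finset.card_image_le.trans (hattc y hy)
    have h2 : (R.biUnion Φ).card ≤ R.card * (W.card + k) :=
      Finset.card_biUnion_le_card_mul _ _ _ fun f _ => by simpa using hΦc f
    have h3 : R.card * (W.card + k) ≤ 2 * k * (W.card + k) := Nat.mul_le_mul_right _ hRc
    refine (Finset.card_union_le _ _).trans (Nat.add_le_add ?_ (h2.trans h3))
    refine (Finset.card_union_le _ _).trans (Nat.add_le_add ?_ hPc)
    refine (Finset.card_union_le _ _).trans (Nat.add_le_add le_rfl ?_)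
    rwa [mul_comm]
  · intro D hD S hS x hx hxS
    simp only [Finset.mem_union] at hD
    have hDatt : ∀ y ∈ F, ∀ z ∈ att y, D y z := fun y hy z hz =>
      hD (y, z) (Or.inl (Or.inl (Or.inr (Finset.mem_biUnion.2
        ⟨y, hy, Finset.mem_image_of_mem _ hz⟩))))
    have hfull : ∀ y ∈ F, y ∉ Ex → y ∉ S → Reach D S y x := by
      intro y hy hyEx hyS
      refine hub D (fun e he => hD e (Or.inl (Or.inl (Or.inl he)))) S hS y hyS (fun i hi => ?_)
        x hx hxS
      rcases hatt y hy with ⟨-, h⟩ | ⟨h, -⟩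
      · obtain ⟨u, hu, huK⟩ := h i hi
        exact ⟨u, hu, hDatt y hy u huK⟩
      · exact absurd h hyEx
    refine ⟨hfull, fun pos N hpos hstep => ?_⟩
    have hexists : ∀ K : Finset V, k ≤ K.card → ∃ z ∈ K, z ∉ S := by
      intro K hK
      by_contra! hcon
      have := Finset.card_le_card (show K ⊆ S from hcon)
      omega
    have hout : ∀ v, v ∉ S → v ∉ W → Reach D S v x := by
      refine reach_of_rank (fun v => (if v ∈ Ex then N + 1 else 0) + (N - pos v)) _ ?_
      intro v hvS hvW
      by_cases hvF : v ∈ F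
      · rcases hatt v hvF with ⟨h, -⟩ | ⟨hvEx, hKc, hK⟩
        · exact Or.inl (hfull v hvF h hvS)
        · obtain ⟨z, hz, hzS⟩ := hexists _ hKc
          refine Or.inr ⟨z, hzS, (hK z hz).1, ?_, hDatt v hvF z hz⟩
          simp only [(hK z hz).2, hvEx, if_false, if_true]
          omega
      · rcases hstep v hvW hvF hvS with h | ⟨z, hzS, hzW, hvz, hEx, hlt⟩
        · exact Or.inl h
        · refine Or.inr ⟨z, hzS, hzW, ?_, hvz⟩
          have := hpos z
          by_cases hz : z ∈ Ex
          · simp only [hz, hEx hz, if_true]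
            omega
          · simp only [hz, if_false]
            omega
    have hin : ∀ v, v ∉ S → v ∈ W → Reach D S v x := by
      refine reach_of_rank τ _ ?_
      intro w hwS hwW
      by_cases hwR : w ∈ R
      · obtain ⟨z, hz, hzS, hreach⟩ := hΦ w S hS hwS
        refine Or.inl ((hreach.mono fun a b hab => ?_).trans (hout z hzS (Finset.mem_compl.1 hz)))
        exact hD (a, b) (Or.inr (Finset.mem_biUnion.2 ⟨w, hwR, hab⟩))
      · obtain ⟨K, hKc, hK⟩ := hP w hwW hwR
        obtain ⟨z, hz, hzS⟩ := hexists K hKc.ge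
        obtain ⟨h1, h2, h3⟩ := hK z hz
        exact Or.inr ⟨z, hzS, h1, h3, hD (w, z) (Or.inl (Or.inr h2))⟩
    intro v hvS
    by_cases hvW : v ∈ W
    · exact hin v hvS hvW
    · exact hout v hvS hvW

end Dominating

/-! ### Tournaments with few vertices -/

section Small

variable {V : Type*} [Fintype V] {r : V → V → Prop} {k : ℕ}

/-- A peeling of the whole tournament together with fans from its remainder to `Z`. -/
theorem TournamentRel.exists_arcs_to_set (hr : TournamentRel r) (hconn : RobustlyConnected k r)
    {Z : Finset V} (hZ : Z.card = k) :
    ∃ E : Finset (V × V), (∀ e ∈ E, r e.1 e.2) ∧ E.card ≤ 3 * k * Fintype.card V ∧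
      ∀ D : V → V → Prop, (∀ e ∈ E, D e.1 e.2) → ∀ S : Finset V, S.card < k →
        ∀ v, v ∉ S → ∃ z ∈ Z, z ∉ S ∧ Reach D S v z := by
  obtain ⟨P, R, τ, -, hRc, hPc, hPr, hP⟩ := hr.exists_peeling k Finset.univ
  have hfan := fun f => hconn.exists_fan f hZ.ge
  choose Φ hΦc hΦr hΦ using hfan
  refine ⟨P ∪ R.biUnion Φ, ?_, ?_, ?_⟩
  · intro e he
    rcases Finset.mem_union.1 he with he | he
    · exact hPr e he
    · obtain ⟨f, -, he⟩ := Finset.mem_biUnion.1 he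
      exact hΦr f e he
  · have h0 : Zᶜ.card + k = Fintype.card V := by rw [← hZ, Finset.card_compl_add_card]
    have h1 : (R.biUnion Φ).card ≤ R.card * Fintype.card V :=
      Finset.card_biUnion_le_card_mul _ _ _ fun f _ => (hΦc f).trans h0.le
    have h2 : R.card * Fintype.card V ≤ 2 * k * Fintype.card V := Nat.mul_le_mul_right _ hRc
    rw [Finset.card_univ] at hPc
    refine (Finset.card_union_le _ _).trans ((Nat.add_le_add hPc (h1.trans h2)).trans ?_)
    exact (by ring : k * Fintype.card V + 2 * k * Fintype.card V = 3 * k * Fintype.card V).le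
  · intro D hD S hS v
    induction hn : τ v using Nat.strong_induction_on generalizing v with
    | _ n ih =>
      intro hv
      by_cases hvR : v ∈ R
      · obtain ⟨z, hz, hzS, hreach⟩ := hΦ v S hS hv
        exact ⟨z, hz, hzS, hreach.mono fun a b hab =>
          hD (a, b) (Finset.mem_union_right _ (Finset.mem_biUnion.2 ⟨v, hvR, hab⟩))⟩
      · obtain ⟨K, hKc, hK⟩ := hP v (Finset.mem_univ v) hvR
        obtain ⟨u, hu, huS⟩ : ∃ u ∈ K, u ∉ S := by
          by_contra! hcon
          have := Finset.card_le_card (show K ⊆ S from hcon)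
          omega
        obtain ⟨-, h2, h3⟩ := hK u hu
        obtain ⟨z, hz, hzS, hreach⟩ := ih (τ u) (hn ▸ h3) u rfl huS
        exact ⟨z, hz, hzS, (Reach.single (hD (v, u) (Finset.mem_union_left _ h2)) hv huS).trans
          hreach⟩

/-- A spanning subgraph that is sparse enough when the number of vertices is of order
`k * log k`. -/
theorem TournamentRel.exists_sparse_of_small (hr : TournamentRel r) (hconn : RobustlyConnected k r)
    (hn : 7 * k ≤ Fintype.card V) :
    ∃ D : Finset (V × V), (∀ e ∈ D, r e.1 e.2) ∧ RobustlyConnected k (ArcRel D) ∧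
      D.card ≤ 6 * k * Fintype.card V + 49 * k ^ 2 := by
  obtain ⟨J, -, hJ⟩ := Finset.exists_subset_card_eq (s := (Finset.univ : Finset V)) (n := 7 * k)
    (by simpa using hn)
  obtain ⟨L, -, X, -, hLc, hXc, hLX⟩ := hr.exists_robust_sets hJ.ge
  obtain ⟨E₁, hE₁r, hE₁c, hE₁⟩ := hr.exists_arcs_to_set hconn hLc
  obtain ⟨E₂, hE₂r, hE₂c, hE₂⟩ := hr.flip.exists_arcs_to_set hconn.flip hXc
  refine ⟨(J ×ˢ J).filter (fun e => r e.1 e.2) ∪ E₁ ∪ E₂.image Prod.swap, ?_, ?_, ?_⟩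
  · intro e he
    simp only [Finset.mem_union, Finset.mem_filter] at he
    rcases he with (he | he) | he
    · exact he.2
    · exact hE₁r e he
    · obtain ⟨e', he', rfl⟩ := Finset.mem_image.1 he
      exact hE₂r e' he'
  · intro S hS u v hu hv
    set D := (J ×ˢ J).filter (fun e => r e.1 e.2) ∪ E₁ ∪ E₂.image Prod.swap with hD
    obtain ⟨a, ha, haS, hua⟩ := hE₁ (ArcRel D) (fun e he =>
      Finset.mem_union_left _ (Finset.mem_union_right _ he)) S hS u hu
    obtain ⟨x, hx, hxS, hxv⟩ := hE₂ (_root_.flip (ArcRel D)) (fun e he =>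
      Finset.mem_union_right _ (Finset.mem_image_of_mem Prod.swap he)) S hS v hv
    refine (hua.trans ((hLX S hS a ha x hx haS hxS).mono fun y z hyz => ?_)).trans hxv.unflip
    exact Finset.mem_union_left _ (Finset.mem_union_left _ (Finset.mem_filter.2
      ⟨Finset.mem_product.2 ⟨hyz.2.1, hyz.2.2⟩, hyz.1⟩))
  · have h1 : ((J ×ˢ J).filter fun e => r e.1 e.2).card ≤ 49 * k ^ 2 := by
      refine (Finset.card_filter_le _ _).trans ?_
      rw [Finset.card_product, hJ]
      exact (by ring : 7 * k * (7 * k) = 49 * k ^ 2).le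
    have h2 : (E₂.image Prod.swap).card ≤ 3 * k * Fintype.card V :=
      Finset.card_image_le.trans hE₂c
    have h3 := Finset.card_union_le ((J ×ˢ J).filter (fun e => r e.1 e.2) ∪ E₁)
      (E₂.image Prod.swap)
    have h4 := Finset.card_union_le ((J ×ˢ J).filter (fun e => r e.1 e.2)) E₁
    have h5 : 6 * k * Fintype.card V = 3 * k * Fintype.card V + 3 * k * Fintype.card V := by ring
    omega

end Small

/-! ### Tournaments with many vertices -/

section Large

variable {V : Type*} {r : V → V → Prop} {k : ℕ}

theorem Linkage.card_pathArcs_out_le_one {A B : Finset V} {p : Fin k → ℕ → V} {L : Fin k → ℕ}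
    (h : Linkage r A B p L) (u : V) : ((pathArcs p L).filter fun e => e.1 = u).card ≤ 1 := by
  refine Finset.card_le_one.2 fun e he e' he' => ?_
  rw [Finset.mem_filter] at he he'
  obtain ⟨i, s, hs, rfl⟩ := mem_pathArcs.1 he.1
  obtain ⟨j, t, ht, rfl⟩ := mem_pathArcs.1 he'.1
  obtain ⟨rfl, rfl⟩ := h.inj i j s t hs.le ht.le (he.2.trans he'.2.symm)
  rfl

theorem Linkage.card_pathArcs_in_le_one {A B : Finset V} {p : Fin k → ℕ → V} {L : Fin k → ℕ}
    (h : Linkage r A B p L) (u : V) : ((pathArcs p L).filter fun e => e.2 = u).card ≤ 1 := by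
  refine Finset.card_le_one.2 fun e he e' he' => ?_
  rw [Finset.mem_filter] at he he'
  obtain ⟨i, s, hs, rfl⟩ := mem_pathArcs.1 he.1
  obtain ⟨j, t, ht, rfl⟩ := mem_pathArcs.1 he'.1
  obtain ⟨rfl, hst⟩ := h.inj i j (s + 1) (t + 1) hs ht (he.2.trans he'.2.symm)
  obtain rfl : s = t := by omega
  rfl

variable [Fintype V]

/-- The sparse spanning subgraph of a large tournament, with dominating sets of at most `c + 1`
vertices. Its arcs are those of the backward paths, of an acyclic digraph on each block, and the arcs
that lead from the ends of the blocks to the dominating sets and, reversed, from the dominating sets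
to the beginnings of the blocks. -/
theorem TournamentRel.exists_sparse_of_large (hr : TournamentRel r) (hconn : RobustlyConnected k r)
    (hk : 1 ≤ k) {c : ℕ} (hc₁ : 24 * k ≤ 2 ^ c) (hc₂ : 2 * (6 * k * (c + 1) + 1 + k) ≤ 2 ^ c)
    (hn : 8 * k * (c + 1) < Fintype.card V) :
    ∃ D : Finset (V × V), (∀ e ∈ D, r e.1 e.2) ∧ RobustlyConnected k (ArcRel D) ∧
      D.card ≤ k * Fintype.card V + (5 * k + 1) * (6 * k * (c + 1) + 1) + 6 * k * (c + 1) +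
        310 * k ^ 2 := by
  have hkc : k ≤ k * (c + 1) := Nat.le_mul_of_pos_right k (Nat.succ_pos c)
  have hn' : 8 * (k * (c + 1)) < Fintype.card V := by rwa [← mul_assoc]
  have hc₂' : 2 * (6 * (k * (c + 1)) + 1 + k) ≤ 2 ^ c := by rwa [← mul_assoc]
  -- The centres of the dominating sets: the vertices of smallest out-degree, and then the vertices
  -- of smallest in-degree.
  obtain ⟨LB, -, hLBc, hLB⟩ := Finset.univ.exists_subset_card_minimizing
    (fun v => (Finset.univ.filter (r v)).card) (k := 3 * k) (by rw [Finset.card_univ]; omega)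
  obtain ⟨LA, hLAs, hLAc, hLA⟩ := (LBᶜ).exists_subset_card_minimizing
    (fun v => (Finset.univ.filter fun z => r z v).card) (k := 3 * k)
    (by rw [Finset.card_compl]; omega)
  have hLBA : Disjoint LB LA := by
    rw [Finset.disjoint_left]
    exact fun y hy hy' => Finset.mem_compl.1 (hLAs hy') hy
  set MB := LB.sup fun v => (Finset.univ.filter (r v)).card with hMB
  set MA := LA.sup fun v => (Finset.univ.filter fun z => r z v).card with hMA
  have hMBle : ∀ y, y ∉ LB → MB ≤ (Finset.univ.filter (r y)).card := fun y hy =>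
    Finset.sup_le fun a ha => hLB a ha y (Finset.mem_univ y) hy
  have hMAle : ∀ y, y ∉ LB → y ∉ LA → MA ≤ (Finset.univ.filter fun z => r z y).card :=
    fun y hy hy' => Finset.sup_le fun a ha => hLA a ha y (Finset.mem_compl.2 hy) hy'
  have hMBn : MB ≤ Fintype.card V := Finset.sup_le fun _ _ => Finset.card_le_univ _
  have hMAn : MA ≤ Fintype.card V := Finset.sup_le fun _ _ => Finset.card_le_univ _
  obtain ⟨B, X, ExB, EB, hLBs, hBQ, hBc, hXB, hXc, hEBc, hEBr, hubB, hdomB, hExB, hExB'⟩ :=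
    hr.exists_terminal (c := c) (M := MB) hLBc hLBA
      (fun i hi => Finset.le_sup (f := fun v => (Finset.univ.filter (r v)).card) hi)
  obtain ⟨A, Y, ExA, EA, hLAs', hAQ, hAc, hYA, hYc, hEAc, hEAr, hubA, hdomA, hExA, hExA'⟩ :=
    hr.flip.exists_terminal (c := c) (M := MA) hLAc hBQ.symm
      (fun i hi => Finset.le_sup (f := fun v => (Finset.univ.filter fun z => r z v).card) hi)
  set W₀ := LB.biUnion B ∪ LA.biUnion A with hW₀
  have hW₀c : W₀.card ≤ 6 * (k * (c + 1)) := by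
    have h1 : 3 * k * (c + 1) = 3 * (k * (c + 1)) := mul_assoc _ _ _
    rw [hW₀]
    have := Finset.card_union_le (LB.biUnion B) (LA.biUnion A)
    omega
  have hsmall : ∀ (Ex : Finset V) (M : ℕ), Ex.card * 2 ^ c ≤ 3 * k * M → 8 * Ex.card ≤ M := by
    intro Ex M h
    have h1 : Ex.card * (24 * k) ≤ Ex.card * 2 ^ c := Nat.mul_le_mul_left _ hc₁
    have h2 : (3 * k) * (8 * Ex.card) ≤ (3 * k) * M := by
      calc (3 * k) * (8 * Ex.card) = Ex.card * (24 * k) := by ring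
        _ ≤ _ := h1.trans h
    exact Nat.le_of_mul_le_mul_left h2 (by omega)
  have hExBc := hsmall _ _ hExB
  have hExAc := hsmall _ _ hExA
  -- A vertex `ys` with an in-neighbour in every set `A i` and an out-neighbour in every set `B i`.
  obtain ⟨ys, hys⟩ : ∃ y, y ∉ W₀ ∪ ExB ∪ ExA := by
    by_contra! hcon
    have h1 : Fintype.card V ≤ (W₀ ∪ ExB ∪ ExA).card := by
      rw [← Finset.card_univ]
      exact Finset.card_le_card fun y _ => hcon y
    have h2 := Finset.card_union_le (W₀ ∪ ExB) ExA
    have h3 := Finset.card_union_le W₀ ExB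
    omega
  simp only [Finset.mem_union, not_or] at hys
  have hysW₀ : ys ∉ W₀ := hys.1.1
  set W := insert ys W₀ with hWdef
  have hWc : W.card ≤ 6 * (k * (c + 1)) + 1 := (Finset.card_insert_le _ _).trans (by omega)
  have hWW : Wᶜ.card + W.card = Fintype.card V := Finset.card_compl_add_card W
  have hWk : k ≤ Wᶜ.card := by omega
  have hdegcount : ∀ (N Ex : Finset V) (M : ℕ), 8 * Ex.card ≤ M → 2 ^ c ≤ M → M ≤ N.card →
      k ≤ (N \ (W ∪ Ex)).card := by
    intro N Ex M h1 h2 h3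
    have h4 := Finset.le_card_sdiff (W ∪ Ex) N
    have h5 := Finset.card_union_le W Ex
    omega
  have hnotLB : ∀ y, y ∉ W₀ → y ∉ LB := fun y hy h => hy (Finset.mem_union_left _ (hLBs h))
  have hnotLA : ∀ y, y ∉ W₀ → y ∉ LA := fun y hy h => hy (Finset.mem_union_right _ (hLAs' h))
  -- The backward paths.
  obtain ⟨p, L, hp, hchord, -⟩ := exists_chordless_linkage (r := r) (A := X) (B := Y) (k := k) (by
    intro S hS
    have hpick : ∀ Z : Finset V, Z.card = k → ∃ z ∈ Z, z ∉ S := by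
      intro Z hZ
      by_contra! hcon
      have := Finset.card_le_card (show Z ⊆ S from hcon)
      omega
    obtain ⟨x, hx, hxS⟩ := hpick X hXc
    obtain ⟨y, hy, hyS⟩ := hpick Y hYc
    exact ⟨x, hx, y, hy, hxS, hyS, hconn S hS x y hxS hyS⟩)
  set VP := Finset.univ.filter fun v => ∃ i t, t ≤ L i ∧ v = p i t with hVP
  -- The blocks, on each of which an acyclic digraph with large degrees is chosen.
  let cl : V → Bool × Bool × Bool := fun v => (decide (v ∈ VP), decide (v ∈ ExA), decide (v ∈ ExB))
  let q : Bool × Bool × Bool → ℕ := fun t => if t.1 then k - 1 else k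
  have hblock := fun t : Bool × Bool × Bool =>
    haveI : Inhabited V := ⟨ys⟩
    hr.exists_acyclic_regular ((Wᶜ).filter fun v => cl v = t)
      (if t.1 then pathArcs p L else ∅) (s := if t.1 then 1 else 0) (m := 6 * k - 4) (q := q t)
      (by
        intro u
        split_ifs
        · exact hp.card_pathArcs_out_le_one u
        · simp)
      (by
        intro u
        split_ifs
        · exact hp.card_pathArcs_in_le_one u
        · simp)
      (by
        simp only [q]
        split_ifs <;> omega)
  choose H pos Fo Fi hHc hFoc hFic hFoC hFiC hposlt hH hHo hHi using hblock
  have hmemC : ∀ t v, v ∈ (Wᶜ).filter (fun v => cl v = t) ↔ v ∉ W ∧ cl v = t := fun t v => by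
    rw [Finset.mem_filter, Finset.mem_compl]
  set FO := insert ys (Finset.univ.biUnion Fo) with hFO
  set FI := insert ys (Finset.univ.biUnion Fi) with hFI
  have hFcard : ∀ F : Bool × Bool × Bool → Finset V, (∀ t, (F t).card ≤ 6 * k - 4) →
      (insert ys (Finset.univ.biUnion F)).card ≤ 48 * k := by
    intro F hF
    have h1 := Finset.card_biUnion_le_card_mul Finset.univ F _ fun t _ => hF t
    have h2 := Finset.card_insert_le ys (Finset.univ.biUnion F)
    rw [Finset.card_univ, show Fintype.card (Bool × Bool × Bool) = 8 from rfl] at h1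
    omega
  have hFW : ∀ F : Bool × Bool × Bool → Finset V,
      (∀ t, F t ⊆ (Wᶜ).filter fun v => cl v = t) →
      ∀ y ∈ insert ys (Finset.univ.biUnion F), y ∉ W₀ := by
    intro F hF y hy
    rcases Finset.mem_insert.1 hy with rfl | hy
    · exact hysW₀
    · obtain ⟨t, -, hy⟩ := Finset.mem_biUnion.1 hy
      exact fun h => ((hmemC t y).1 (hF t hy)).1 (Finset.mem_insert_of_mem h)
  obtain ⟨EO, hEOr, hEOc, hEO⟩ := hr.exists_outward_arcs (W := W) (Ex := ExB) (F := FO)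
    hconn hEBr hubB hLBc (by omega) hWk
    (fun y hy hyEx => hdomB y (hnotLA y (hFW Fo hFoC y hy))
      (fun h => hFW Fo hFoC y hy (Finset.mem_union_left _ h)) hyEx)
    (fun y hy hyEx => by
      refine (hdegcount _ ExB MB hExBc (hExB' ⟨y, hyEx⟩)
        (hMBle y (hnotLB y (hFW Fo hFoC y hy)))).trans (Finset.card_le_card fun z hz => ?_)
      simpa [not_or] using hz)
  obtain ⟨EI, hEIr, hEIc, hEI⟩ := hr.flip.exists_outward_arcs (W := W) (Ex := ExA) (F := FI)
    hconn.flip hEAr hubA hLAc (by omega) hWk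
    (fun y hy hyEx => hdomA y (fun h => hFW Fi hFiC y hy (Finset.mem_union_left _ h))
      (fun h => hFW Fi hFiC y hy (Finset.mem_union_right _ h)) hyEx)
    (fun y hy hyEx => by
      refine (hdegcount _ ExA MA hExAc (hExA' ⟨y, hyEx⟩)
        (hMAle y (hnotLB y (hFW Fi hFiC y hy)) (hnotLA y (hFW Fi hFiC y hy)))).trans
        (Finset.card_le_card fun z hz => ?_)
      exact Finset.mem_filter.2 ⟨Finset.mem_univ z, by simpa [not_or, _root_.flip] using hz⟩)
  obtain ⟨D, hD⟩ : ∃ D : Finset (V × V),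
      D = Finset.univ.biUnion H ∪ pathArcs p L ∪ EO ∪ EI.image Prod.swap := ⟨_, rfl⟩
  have hDH : ∀ t, ∀ e ∈ H t, e ∈ D := fun t e he => by
    rw [hD]
    simp only [Finset.mem_union]
    exact Or.inl (Or.inl (Or.inl (Finset.mem_biUnion.2 ⟨t, Finset.mem_univ t, he⟩)))
  have hDP : ∀ e ∈ pathArcs p L, e ∈ D := fun e he => by
    rw [hD]
    simp only [Finset.mem_union]
    exact Or.inl (Or.inl (Or.inr he))
  have hDO : ∀ e ∈ EO, ArcRel D e.1 e.2 := fun e he => by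
    rw [hD]
    exact Finset.mem_union_left _ (Finset.mem_union_right _ he)
  have hDI : ∀ e ∈ EI, _root_.flip (ArcRel D) e.1 e.2 := fun e he => by
    rw [hD]
    exact Finset.mem_union_right _ (Finset.mem_image_of_mem Prod.swap he)
  refine ⟨D, ?_, ?_, ?_⟩
  · intro e he
    simp only [hD, Finset.mem_union] at he
    rcases he with ((he | he) | he) | he
    · obtain ⟨t, -, he⟩ := Finset.mem_biUnion.1 he
      exact (hH t e he).1
    · obtain ⟨i, t, ht, rfl⟩ := mem_pathArcs.1 he
      exact hp.step i t ht
    · exact hEOr e he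
    · obtain ⟨e', he', rfl⟩ := Finset.mem_image.1 he
      exact hEIr e' he'
  · intro S hS
    -- Both `ys` and the endpoints of the paths are connected as long as they are not deleted.
    have hysX : ys ∉ S → ∀ x ∈ X, x ∉ S → Reach (ArcRel D) S ys x := fun hysS x hx hxS =>
      (hEO _ hDO S hS x hx hxS).1 ys (Finset.mem_insert_self _ _) hys.1.2 hysS
    have hYys : ys ∉ S → ∀ y ∈ Y, y ∉ S → Reach (ArcRel D) S y ys := fun hysS y hy hyS =>
      ((hEI _ hDI S hS y hy hyS).1 ys (Finset.mem_insert_self _ _) hys.2 hysS).unflip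
    obtain ⟨i, hi⟩ := hp.exists_clean hS
    have hx₀ := hp.start i
    have hy₀ := hp.finish i
    have hx₀S := hi 0 (Nat.zero_le _)
    have hy₀S := hi (L i) le_rfl
    have hpath : Reach (ArcRel D) S (p i 0) (p i (L i)) :=
      (Linkage.reach (p := p) (L := L) (Nat.zero_le _) le_rfl fun u _ hu => hi u hu).mono
        fun a b hab => hDP (a, b) hab
    -- All arcs chosen at `v` in its block lead into `S` only if `v` lies on a path and `S` consists
    -- of the other ends of these arcs.
    have hstuck : ∀ v (K : Finset V), K.card = q (cl v) → (∀ z ∈ K, z ∉ W) → K ⊆ S →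
        S = K ∧ ys ∉ S ∧ (cl v).1 = true := by
      intro v K hKc hKW hKS
      have hle := Finset.card_le_card hKS
      have hv : (cl v).1 = true := by
        by_contra hv
        simp only [q, if_neg hv] at hKc
        omega
      simp only [q, if_pos hv] at hKc
      have hSK : S = K := (Finset.eq_of_subset_of_card_le hKS (by omega)).symm
      refine ⟨hSK, fun h => ?_, hv⟩
      rw [hSK] at h
      exact hKW ys h (Finset.mem_insert_self _ _)
    have hcl : ∀ u v, cl u = cl v → (u ∈ ExA → v ∈ ExA) ∧ (u ∈ ExB → v ∈ ExB) := by
      intro u v huv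
      simp only [cl, Prod.mk.injEq, decide_eq_decide] at huv
      exact ⟨huv.2.1.1, huv.2.2.1⟩
    have hposn : ∀ v, pos (cl v) v * (if v ∈ W then 0 else 1) ≤ Fintype.card V := by
      intro v
      split_ifs with hv
      · simp
      · rw [mul_one]
        exact ((hposlt (cl v) v ((hmemC _ _).2 ⟨hv, rfl⟩)).le).trans (Finset.card_le_univ _)
    obtain ⟨ρ, hρ, hρn⟩ : ∃ ρ : V → ℕ, (∀ v, v ∉ W → ρ v = pos (cl v) v) ∧
        ∀ v, ρ v ≤ Fintype.card V :=
      ⟨fun v => pos (cl v) v * (if v ∈ W then 0 else 1), fun v hv => by simp [hv], hposn⟩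
    have hOut := (hEO _ hDO S hS (p i 0) hx₀ hx₀S).2 ρ (Fintype.card V) hρn (by
      intro v hvW hvF hvS
      have hvC := (hmemC (cl v) v).2 ⟨hvW, rfl⟩
      have hvFo : v ∉ Fo (cl v) := fun h =>
        hvF (Finset.mem_insert_of_mem (Finset.mem_biUnion.2 ⟨cl v, Finset.mem_univ _, h⟩))
      obtain ⟨K, hKc, hK⟩ := hHo (cl v) v hvC hvFo
      have hKprop := fun z (hz : z ∈ K) => hH (cl v) (v, z) (hK z hz)
      have hKC := fun z (hz : z ∈ K) => (hmemC _ _).1 (hKprop z hz).2.2.1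
      by_cases hKS : K ⊆ S
      · left
        obtain ⟨hSK, hysS, hv⟩ := hstuck v K hKc (fun z hz => (hKC z hz).1) hKS
        obtain ⟨j, t, ht, hvt⟩ : ∃ j t, t ≤ L j ∧ v = p j t := by
          simpa [cl, hVP] using hv
        -- A vertex of `S` further along the path would be the end of a chord.
        have hclean : ∀ u, t ≤ u → u ≤ L j → p j u ∉ S := by
          intro u htu hu huS
          rcases htu.eq_or_lt with rfl | htu
          · exact hvS (hvt ▸ huS)
          rw [hSK] at huS
          have h1 := hKprop _ huS
          obtain rfl := hchord j t u htu hu (hvt ▸ h1.1)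
          refine h1.2.2.2.1 ?_
          rw [if_pos hv]
          exact mem_pathArcs.2 ⟨j, t, by omega, by rw [← hvt]⟩
        have h1 : Reach (ArcRel D) S v (p j (L j)) := by
          rw [hvt]
          exact (Linkage.reach (p := p) (L := L) ht le_rfl hclean).mono
            fun a b hab => hDP (a, b) hab
        exact (h1.trans (hYys hysS _ (hp.finish j) (hclean _ ht le_rfl))).trans
          (hysX hysS _ hx₀ hx₀S)
      · right
        obtain ⟨z, hz, hzS⟩ := Finset.not_subset.1 hKS
        refine ⟨z, hzS, (hKC z hz).1, hDH _ _ (hK z hz), (hcl z v (hKC z hz).2).2, ?_⟩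
        rw [hρ v hvW, hρ z (hKC z hz).1, (hKC z hz).2]
        exact (hKprop z hz).2.2.2.2)
    have hIn := (hEI _ hDI S hS (p i (L i)) hy₀ hy₀S).2 (fun v => Fintype.card V - ρ v)
      (Fintype.card V) (fun v => Nat.sub_le _ _) (by
      intro v hvW hvF hvS
      have hvC := (hmemC (cl v) v).2 ⟨hvW, rfl⟩
      have hvFi : v ∉ Fi (cl v) := fun h =>
        hvF (Finset.mem_insert_of_mem (Finset.mem_biUnion.2 ⟨cl v, Finset.mem_univ _, h⟩))
      obtain ⟨K, hKc, hK⟩ := hHi (cl v) v hvC hvFi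
      have hKprop := fun z (hz : z ∈ K) => hH (cl v) (z, v) (hK z hz)
      have hKC := fun z (hz : z ∈ K) => (hmemC _ _).1 (hKprop z hz).2.1
      by_cases hKS : K ⊆ S
      · left
        obtain ⟨hSK, hysS, hv⟩ := hstuck v K hKc (fun z hz => (hKC z hz).1) hKS
        obtain ⟨j, t, ht, hvt⟩ : ∃ j t, t ≤ L j ∧ v = p j t := by
          simpa [cl, hVP] using hv
        have hclean : ∀ u, 0 ≤ u → u ≤ t → p j u ∉ S := by
          intro u _ hut huS
          rcases hut.eq_or_lt with rfl | hut
          · exact hvS (hvt ▸ huS)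
          rw [hSK] at huS
          have h1 := hKprop _ huS
          obtain rfl := hchord j u t hut ht (hvt ▸ h1.1)
          refine h1.2.2.2.1 ?_
          rw [if_pos hv]
          exact mem_pathArcs.2 ⟨j, u, by omega, by rw [← hvt]⟩
        have h1 : Reach (ArcRel D) S (p j 0) v := by
          rw [hvt]
          exact (Linkage.reach (p := p) (L := L) (Nat.zero_le _) ht hclean).mono
            fun a b hab => hDP (a, b) hab
        exact (((hYys hysS _ hy₀ hy₀S).trans
          (hysX hysS _ (hp.start j) (hclean 0 le_rfl (Nat.zero_le _)))).trans h1).flip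
      · right
        obtain ⟨z, hz, hzS⟩ := Finset.not_subset.1 hKS
        refine ⟨z, hzS, (hKC z hz).1, hDH _ _ (hK z hz), (hcl z v (hKC z hz).2).1, ?_⟩
        have h1 := (hKprop z hz).2.2.2.2
        have h2 := hρ v hvW
        have h3 := hρ z (hKC z hz).1
        rw [(hKC z hz).2] at h3
        have h4 := hρn v
        simp only at h1 ⊢
        omega)
    exact fun u v hu hv => ((hOut u hu).trans hpath).trans (hIn v hv).unflip
  · -- The arcs of the blocks and of the paths together number at most `k` per vertex outside `W`.
    have hHcard : (Finset.univ.biUnion H).card ≤ ∑ v ∈ Wᶜ, q (cl v) := by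
      refine Finset.card_biUnion_le.trans ((Finset.sum_le_sum fun t _ => hHc t).trans ?_)
      rw [← Finset.sum_fiberwise (Wᶜ) cl]
      refine Finset.sum_le_sum fun t _ => ?_
      rw [Finset.sum_congr rfl fun v hv => by rw [((hmemC t v).1 hv).2], Finset.sum_const,
        smul_eq_mul, mul_comm]
    have hsum : ∑ v ∈ Wᶜ, q (cl v) + ((Wᶜ).filter fun v => v ∈ VP).card = Wᶜ.card * k := by
      rw [Finset.card_filter, ← Finset.sum_add_distrib, ← smul_eq_mul, ← Finset.sum_const]
      refine Finset.sum_congr rfl fun v _ => ?_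
      simp only [q, cl, decide_eq_true_eq]
      split_ifs <;> omega
    have hPcard : (pathArcs p L).card ≤ ((Wᶜ).filter fun v => v ∈ VP).card + W.card := by
      have h1 := hp.sum_le_card (U := VP) fun i t ht =>
        Finset.mem_filter.2 ⟨Finset.mem_univ _, i, t, ht.le, rfl⟩
      have h2 : VP.card ≤ ((Wᶜ).filter fun v => v ∈ VP).card + W.card := by
        refine (Finset.card_le_card fun v hv => ?_).trans (Finset.card_union_le _ _)
        rw [Finset.mem_union, Finset.mem_filter, Finset.mem_compl]
        tauto
      exact card_pathArcs_le.trans (h1.trans h2)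
    have hDcard : D.card ≤ (Finset.univ.biUnion H).card + (pathArcs p L).card + EO.card +
        EI.card := by
      rw [hD]
      refine (Finset.card_union_le _ _).trans (Nat.add_le_add ?_ Finset.card_image_le)
      refine (Finset.card_union_le _ _).trans (Nat.add_le_add_right ?_ _)
      exact Finset.card_union_le _ _
    have hside : ∀ E F : ℕ, E ≤ 3 * k * (c + 1) + 9 * k ^ 2 → F ≤ 48 * k →
        E + 3 * k * F + k * W.card + 2 * k * (W.card + k) ≤
          3 * k * (c + 1) + 155 * k ^ 2 + 3 * (k * W.card) := by
      intro E F hE hF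
      have h1 : 3 * k * F ≤ 3 * k * (48 * k) := Nat.mul_le_mul_left _ hF
      have h2 : 3 * k * (48 * k) = 144 * k ^ 2 := by ring
      have h3 : 2 * k * (W.card + k) = 2 * (k * W.card) + 2 * k ^ 2 := by ring
      omega
    have hO := hEOc.trans (hside _ _ hEBc (hFcard Fo hFoc))
    have hI := hEIc.trans (hside _ _ hEAc (hFcard Fi hFic))
    have hWmul : (5 * k + 1) * W.card ≤ (5 * k + 1) * (6 * k * (c + 1) + 1) :=
      Nat.mul_le_mul_left _ (hWc.trans (by rw [mul_assoc]))
    have hkn : Wᶜ.card * k + k * W.card = k * Fintype.card V := by rw [← hWW]; ring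
    have e1 : (5 * k + 1) * W.card = 5 * (k * W.card) + W.card := by ring
    have e2 : 6 * k * (c + 1) = 3 * k * (c + 1) + 3 * k * (c + 1) := by ring
    omega

end Large

/-! ### The bound -/

theorem reach_of_deleteVerts {V : Type*} {D : Digraph V} {S : Finset V} {u v : {v : V // v ∉ S}}
    (h : Relation.ReflTransGen (D.deleteVerts S).Adj u v) : Reach D.Adj S u v :=
  Relation.ReflTransGen.lift Subtype.val (fun a b hab => ⟨hab, a.2, b.2⟩) _ _ h

theorem Reach.deleteVerts {V : Type*} {D : Digraph V} {S : Finset V} {u v : V}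
    (h : Reach D.Adj S u v) (hu : u ∉ S) (hv : v ∉ S) :
    Relation.ReflTransGen (D.deleteVerts S).Adj ⟨u, hu⟩ ⟨v, hv⟩ := by
  induction h with
  | refl => exact Relation.ReflTransGen.refl
  | tail _ hbc ih => exact (ih hbc.2.1).tail hbc.1

/-- `c = 2 * clog₂ (k + 1) + 5` is large enough for the dominating sets. -/
theorem two_pow_bounds {k q : ℕ} (hk : 1 ≤ k) (hq : k + 1 ≤ 2 ^ q) :
    24 * k ≤ 2 ^ (2 * q + 5) ∧ 2 * (6 * k * (2 * q + 5 + 1) + 1 + k) ≤ 2 ^ (2 * q + 5) := by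
  have hpow : 2 ^ (2 * q + 5) = 32 * (2 ^ q * 2 ^ q) := by rw [pow_add, two_mul, pow_add]; ring
  rw [hpow]
  have hq0 : q ≠ 0 := by rintro rfl; omega
  obtain rfl | hq2 : q = 1 ∨ 2 ≤ q := by omega
  · obtain rfl : k = 1 := by omega
    norm_num
  have hlin : 24 * q + 76 ≤ 32 * 2 ^ q := by
    clear hq hq0 hpow
    induction q, hq2 using Nat.le_induction with
    | base => norm_num
    | succ q h ih => rw [pow_succ]; omega
  have h1 : (k + 1) * (24 * q + 76) ≤ 2 ^ q * (32 * 2 ^ q) := Nat.mul_le_mul hq hlin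
  constructor <;> nlinarith

theorem theorem1p1 {V : Type*} [Fintype V] (k : ℕ) (hk : 1 ≤ k) (T : Digraph V)
    (hT : T.IsTournament) (hconn : T.StronglyKConnected k) :
    ∃ D : Digraph V, D ≤ T ∧ D.StronglyKConnected k ∧
      (D.arcSet.ncard : ℝ) ≤
        (k : ℝ) * (Fintype.card V : ℝ) + 750 * (k : ℝ) ^ 2 * Real.logb 2 ((k : ℝ) + 1) := by
  have hr : TournamentRel T.Adj := ⟨hT.irrefl, hT.adj_iff_not_adj⟩
  have hrc : RobustlyConnected k T.Adj := fun S hS u v hu hv =>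
    reach_of_deleteVerts (hconn.2 S hS ⟨u, hu⟩ ⟨v, hv⟩)
  set n := Fintype.card V with hn
  set q := Nat.clog 2 (k + 1) with hq
  have hkq : k + 1 ≤ 2 ^ q := Nat.le_pow_clog (by norm_num) _
  have hlog : (q : ℝ) ≤ Real.logb 2 ((k : ℝ) + 1) + 1 := by
    have h1 : 2 ^ (q - 1) < k + 1 := Nat.pow_pred_clog_lt_self (by norm_num) (by omega)
    have hq1 : 1 ≤ q := by
      by_contra h
      have : q = 0 := by omega
      rw [this] at hkq
      omega
    have h2 : ((q - 1 : ℕ) : ℝ) ≤ Real.logb 2 ((k : ℝ) + 1) := by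
      rw [Real.le_logb_iff_rpow_le (by norm_num) (by positivity), Real.rpow_natCast]
      exact_mod_cast h1.le
    rw [Nat.cast_sub hq1] at h2
    push_cast at h2
    linarith
  have hlog1 : 1 ≤ Real.logb 2 ((k : ℝ) + 1) := by
    rw [Real.le_logb_iff_rpow_le (by norm_num) (by positivity), Real.rpow_one]
    have : (1 : ℝ) ≤ k := by exact_mod_cast hk
    linarith
  set ℓ := Real.logb 2 ((k : ℝ) + 1) with hℓ
  have hkR : (1 : ℝ) ≤ k := by exact_mod_cast hk
  -- It suffices to find a sparse set of arcs.
  suffices h : ∃ D : Finset (V × V), (∀ e ∈ D, T.Adj e.1 e.2) ∧ RobustlyConnected k (ArcRel D) ∧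
      (D.card : ℝ) ≤ (k : ℝ) * (n : ℝ) + 750 * (k : ℝ) ^ 2 * ℓ by
    obtain ⟨D, hDT, hDc, hDcard⟩ := h
    refine ⟨⟨ArcRel D⟩, fun u v huv => hDT (u, v) huv, ⟨hconn.1, fun S hS u v => ?_⟩, ?_⟩
    · exact (hDc S hS u v u.2 v.2).deleteVerts u.2 v.2
    · have : (Digraph.arcSet ⟨ArcRel D⟩ : Set (V × V)) = (D : Set (V × V)) := rfl
      rw [this, Set.ncard_coe_finset]
      exact hDcard
  have hk2 : (1 : ℝ) ≤ (k : ℝ) ^ 2 := one_le_pow₀ hkR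
  have hk2ℓ : (k : ℝ) ^ 2 ≤ (k : ℝ) ^ 2 * ℓ := le_mul_of_one_le_right (by positivity) hlog1
  have hkn : 0 ≤ (k : ℝ) * (n : ℝ) := by positivity
  by_cases h7 : n < 7 * k
  · -- All arcs of `T` are kept.
    refine ⟨Finset.univ.filter fun e => T.Adj e.1 e.2, by simp, fun S hS u v hu hv =>
      (hrc S hS u v hu hv).mono fun a b hab => by simpa [ArcRel] using hab, ?_⟩
    have h1 : (Finset.univ.filter fun e : V × V => T.Adj e.1 e.2).card ≤ n * n := by
      refine (Finset.card_le_univ _).trans ?_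
      rw [Fintype.card_prod]
    have h2 : n * n ≤ 7 * k * (7 * k) := Nat.mul_le_mul h7.le h7.le
    have h3 : ((Finset.univ.filter fun e : V × V => T.Adj e.1 e.2).card : ℝ) ≤
        7 * k * (7 * k) := by exact_mod_cast h1.trans h2
    nlinarith
  push Not at h7
  by_cases hsmall : n ≤ 8 * k * (2 * q + 5 + 1)
  · obtain ⟨D, hDT, hDc, hDcard⟩ := hr.exists_sparse_of_small hrc h7
    refine ⟨D, hDT, hDc, ?_⟩
    have h1 : (D.card : ℝ) ≤ 6 * k * n + 49 * (k : ℝ) ^ 2 := by exact_mod_cast hDcard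
    have h2 : (n : ℝ) ≤ 8 * k * (2 * q + 5 + 1) := by exact_mod_cast hsmall
    have h3 : (n : ℝ) ≤ 80 * k * ℓ := by nlinarith
    have h4 : (k : ℝ) * n ≤ k * (80 * k * ℓ) := mul_le_mul_of_nonneg_left h3 (by positivity)
    nlinarith
  · push Not at hsmall
    obtain ⟨hc₁, hc₂⟩ := two_pow_bounds hk hkq
    obtain ⟨D, hDT, hDc, hDcard⟩ := hr.exists_sparse_of_large hrc hk hc₁ hc₂ hsmall
    refine ⟨D, hDT, hDc, ?_⟩
    have h1 : (D.card : ℝ) ≤ k * n + (5 * k + 1) * (6 * k * (2 * q + 5 + 1) + 1) +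
        6 * k * (2 * q + 5 + 1) + 310 * (k : ℝ) ^ 2 := by exact_mod_cast hDcard
    have hq0 : (0 : ℝ) ≤ q := Nat.cast_nonneg _
    have hkk : (k : ℝ) ≤ (k : ℝ) ^ 2 := by nlinarith
    have hkkq : (k : ℝ) * q ≤ (k : ℝ) ^ 2 * q := mul_le_mul_of_nonneg_right hkk hq0
    have h2 : (D.card : ℝ) ≤ k * n + (k : ℝ) ^ 2 * (84 * q + 568) := by nlinarith
    have h3 : (k : ℝ) ^ 2 * (84 * q + 568) ≤ (k : ℝ) ^ 2 * (750 * ℓ) :=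
      mul_le_mul_of_nonneg_left (by linarith) (by positivity)
    nlinarith
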